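/- Let $\gamma$ be Euler's constant, $H_m=\sum_{j=1}^m 1/j$ (with $H_0=0$), and for integers $n\ge 1$ put \[ b_n = n(1-\gamma-H_{n-1})-\frac12+\sum_{k=2}^n\binom nk(-1)^k\zeta(k). \] Then: (i) The $b_n$ are the coefficients of the Newton series $\sum_n(-1)^n b_n\binom sn$ associated to the function $\phi(s)=\zeta(s)-\frac1{s-1}$ (with $\phi(1)$ defined as the limit of $\phi(s)$ as $s\to1$), that is, $b_n=\sum_{k=0}^n\binom nk(-1)^k\phi(k)$ for every $n\ge1$. (ii) As $n\to\infty$, \[ b_n=\left(\frac{2n}{\pi}\right)^{1/4}e^{-2\sqrt{\pi n}}\cos\left(2\sqrt{\pi n}-\frac{5\pi}8\right)+O\left(n^{-1/4}e^{-2\sqrt{\pi n}}\right). \] -/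

import Mathlib

open Filter Topology Asymptotics

noncomputable section

/-- The coefficients `c_n = ∑_{k=0}^n C(n,k) (-1)^k φ(k)` of the Newton series
`∑_n (-1)^n c_n C(s,n)` associated to a function `φ`. -/
def newtonCoeff (φ : ℂ → ℂ) (n : ℕ) : ℂ :=
  ∑ k ∈ Finset.range (n + 1), (n.choose k : ℂ) * (-1) ^ k * φ k

/-- The function `ζ(s) - 1/(s-1)`, extended to `s = 1` by its limit there. -/
def regZeta : ℂ → ℂ :=
  Function.update (fun s : ℂ => riemannZeta s - 1 / (s - 1)) 1
    (limUnder (𝓝[≠] (1 : ℂ)) fun s : ℂ => riemannZeta s - 1 / (s - 1))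

/-- `b_n = n (1 - γ - H_{n-1}) - 1/2 + ∑_{k=2}^n C(n,k) (-1)^k ζ(k)`, used for `n ≥ 1`. -/
def b (n : ℕ) : ℂ :=
  n * (1 - (Real.eulerMascheroniConstant : ℂ) - ((harmonic (n - 1) : ℚ) : ℂ)) - 1 / 2
    + ∑ k ∈ Finset.Icc 2 n, (n.choose k : ℂ) * (-1) ^ k * riemannZeta k

/-- The main term `(2n/π)^{1/4} e^{-2√(πn)} cos(2√(πn) - 5π/8)`. -/
def mainTerm (n : ℕ) : ℝ :=
  (2 * n / Real.pi) ^ (1 / 4 : ℝ) * Real.exp (-2 * √(Real.pi * n))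
    * Real.cos (2 * √(Real.pi * n) - 5 * Real.pi / 8)

end

/-! Write φ for `regZeta`. Part (i) is bookkeeping: φ(0) = 1/2, φ(1) = γ, and the alternating
binomial sum of the pole parts 1/(k-1) is a harmonic number expression.

For (ii), the kernel 1/(e^t-1) + 1/2 - 1/t has two descriptions. Times e^{-t}, its Mellin transform
is Γ(s)(φ(s) - 1/2). By the partial fractions of the cotangent it is also ∑_{j≥1} 2t/(t² + (2πj)²).
Integrating the series termwise gives φ(k) - 1/2 = ∑_{j≥1} 2 Re ∫ e^{-2πiju} (1+u)^{-k} du over the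
ray arg u = -π/4 (`hasSum_rayIntegral`). The binomial theorem turns (1+u)^{-k} into (u/(1+u))^n, and
the constant 1/2 drops out because n ≥ 1. So b_n is an absolutely convergent series of integrals
(`hasSum_noerlundIntegral`).

On the ray u = se^{-iπ/4}, (u/(1+u))^n is about exp(-n/u + n/(2u²)), so the j-th integrand is
concentrated near s = √(n/(2πj)) and has size about e^{-2√(πjn)}. The terms j ≥ 2 are therefore
exponentially smaller (`b_sub_noerlundIntegral_isBigO`). For j = 1, put s = √(n/(2π)) e^x: the
exponent becomes -r²(1+i) cosh x with r² = 2√(πn), and n/(2u²) becomes the phase iπe^{-2x}, equal to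
iπ at the saddle. The Gaussian approximation at x = 0 gives the main term. The linear term of the
amplitude is odd and integrates to zero, so the relative error is O(r^{-2}) = O(n^{-1/2}), which
takes n^{1/4} to n^{-1/4}. Replacing (u/(1+u))^n by its exponential approximation costs a relative
error O(n/s³), of the same order. -/

/-! ### Binomial sums and part (i). -/

lemma sum_choose_neg_one_pow_div (n : ℕ) :
    ∑ k ∈ Finset.range n, (n.choose (k + 1) : ℚ) * (-1) ^ k / (k + 1) = harmonic n := by
  induction n with
  | zero => simp
  | succ n ih =>
    rw [harmonic_succ, ← ih, Finset.sum_range_succ]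
    -- Pascal's rule, then absorption: C(n,k)/(k+1) = C(n+1,k+1)/(n+1). The second parts form a
    -- vanishing alternating sum with its k = 0 term removed.
    have h : ∀ k ∈ Finset.range n, ((n + 1).choose (k + 1) : ℚ) * (-1) ^ k / (k + 1) =
        (n.choose (k + 1) : ℚ) * (-1) ^ k / (k + 1) +
          (((n + 1).choose (k + 1) : ℚ) * (-1) ^ k) / (n + 1) := by
      intro k _
      have h1 : ((n : ℚ) + 1) * n.choose k = (n + 1).choose (k + 1) * (k + 1) := by
        exact_mod_cast Nat.add_one_mul_choose_eq n k
      have h2 : ((n + 1).choose (k + 1) : ℚ) = n.choose k + n.choose (k + 1) := by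
        exact_mod_cast Nat.choose_succ_succ n k
      have : (k : ℚ) + 1 ≠ 0 := by positivity
      have : (n : ℚ) + 1 ≠ 0 := by positivity
      field_simp
      linear_combination ((n : ℚ) + 1) * h2 + h1
    rw [Finset.sum_congr rfl h, Finset.sum_add_distrib, add_assoc]
    congr 1
    have h0 : ∑ k ∈ Finset.range (n + 2), ((n + 1).choose k : ℚ) * (-1) ^ k = 0 := by
      have := Int.alternating_sum_range_choose (n := n + 1)
      rw [if_neg (by omega)] at this
      have h := congrArg (Int.cast : ℤ → ℚ) this
      push_cast at h
      rw [← h]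
      exact Finset.sum_congr rfl fun _ _ => mul_comm _ _
    rw [Finset.sum_range_succ', Finset.sum_range_succ] at h0
    rw [← Finset.sum_div, Nat.choose_self] at *
    simp only [pow_succ, Nat.choose_zero_right, mul_neg, mul_one, Finset.sum_neg_distrib,
      pow_zero] at h0
    field_simp
    push_cast at h0 ⊢
    linear_combination (-(n : ℚ) - 1) * h0

/-- By Pascal's rule the increment in `n` is the preceding harmonic sum. This evaluates the
contribution of the poles 1/(s-1) to the Newton coefficient. -/
lemma sum_Icc_choose_neg_one_pow_div_sub_one (n : ℕ) :
    ∑ k ∈ Finset.Icc 2 (n + 1), ((n + 1).choose k : ℚ) * (-1) ^ k / (k - 1) =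
      (n + 1) * harmonic n - n := by
  rw [show Finset.Icc 2 (n + 1) = Finset.Ico 2 (n + 2) from rfl, Finset.sum_Ico_eq_sum_range,
    show n + 2 - 2 = n by omega]
  induction n with
  | zero => simp
  | succ n ih =>
    have h : ∀ k ∈ Finset.range (n + 1), ((n + 1 + 1).choose (2 + k) : ℚ) * (-1) ^ (2 + k) /
        ((2 + k : ℕ) - 1) = ((n + 1).choose (2 + k) : ℚ) * (-1) ^ (2 + k) / ((2 + k : ℕ) - 1) +
          ((n + 1).choose (k + 1) : ℚ) * (-1) ^ k / (k + 1) := by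
      intro k _
      have h2 : ((n + 1 + 1).choose (2 + k) : ℚ) =
          (n + 1).choose (k + 1) + (n + 1).choose (2 + k) := by
        rw [add_comm 2 k]
        exact_mod_cast Nat.choose_succ_succ (n + 1) (k + 1)
      rw [h2, pow_add]
      push_cast
      rw [show (2 : ℚ) + k - 1 = k + 1 by ring]
      ring
    rw [Finset.sum_congr rfl h, Finset.sum_add_distrib, sum_choose_neg_one_pow_div,
      Finset.sum_range_succ, ih, Nat.choose_eq_zero_of_lt (by omega : n + 1 < 2 + n), harmonic_succ]
    push_cast
    field_simp
    ring

lemma regZeta_one : regZeta 1 = Real.eulerMascheroniConstant := by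
  rw [regZeta, Function.update_self]
  exact tendsto_riemannZeta_sub_one_div.limUnder_eq

lemma regZeta_of_ne_one {s : ℂ} (hs : s ≠ 1) : regZeta s = riemannZeta s - 1 / (s - 1) := by
  rw [regZeta, Function.update_of_ne hs]

lemma regZeta_zero : regZeta 0 = 1 / 2 := by
  rw [regZeta_of_ne_one zero_ne_one, riemannZeta_zero]
  norm_num

theorem b_eq_newtonCoeff {n : ℕ} (hn : 1 ≤ n) : b n = newtonCoeff regZeta n := by
  obtain ⟨m, rfl⟩ : ∃ m, n = m + 1 := ⟨n - 1, by omega⟩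
  have h := congrArg (Rat.cast : ℚ → ℂ) (sum_Icc_choose_neg_one_pow_div_sub_one m)
  push_cast at h
  have h1 : newtonCoeff regZeta (m + 1) = regZeta 0 - (m + 1) * regZeta 1 +
      ∑ k ∈ Finset.Icc 2 (m + 1), ((m + 1).choose k : ℂ) * (-1) ^ k * regZeta k := by
    rw [newtonCoeff, Finset.range_eq_Ico, Finset.sum_eq_sum_Ico_succ_bot (by omega),
      Finset.sum_eq_sum_Ico_succ_bot (by omega)]
    simp only [Nat.choose_zero_right, Nat.choose_one_right, pow_zero, pow_one, zero_add]
    rw [show Finset.Icc 2 (m + 1) = Finset.Ico (1 + 1) (m + 1 + 1) from rfl]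
    push_cast
    ring
  have h2 : ∀ k ∈ Finset.Icc 2 (m + 1), ((m + 1).choose k : ℂ) * (-1) ^ k * regZeta k =
      ((m + 1).choose k : ℂ) * (-1) ^ k * riemannZeta k -
        ((m + 1).choose k : ℂ) * (-1) ^ k / (k - 1) := by
    intro k hk
    have : (k : ℂ) ≠ 1 := by
      have := (Finset.mem_Icc.1 hk).1
      exact_mod_cast (by omega : k ≠ 1)
    rw [regZeta_of_ne_one this]
    ring
  rw [h1, Finset.sum_congr rfl h2, Finset.sum_sub_distrib, h, regZeta_zero, regZeta_one, b]
  simp only [Nat.add_sub_cancel]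
  push_cast
  ring

/-! ### Laplace integrals of powers with complex rate. -/

lemma tendsto_pow_mul_cexp_neg_mul_atTop (k : ℕ) {r : ℂ} (hr : 0 < r.re) :
    Tendsto (fun t : ℝ => (t : ℂ) ^ k * Complex.exp (-(r * t))) atTop (𝓝 0) := by
  rw [tendsto_zero_iff_norm_tendsto_zero]
  have h := tendsto_rpow_mul_exp_neg_mul_atTop_nhds_zero k r.re hr
  refine h.congr' ?_
  filter_upwards [eventually_gt_atTop 0] with t ht
  simp [Complex.norm_exp, abs_of_pos ht]

lemma integrableOn_pow_mul_exp_neg_mul (k : ℕ) {r : ℝ} (hr : 0 < r) :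
    MeasureTheory.IntegrableOn (fun t : ℝ => t ^ k * Real.exp (-(r * t))) (Set.Ioi 0) := by
  have h := integrableOn_rpow_mul_exp_neg_mul_rpow (s := k) (p := 1) (b := r)
    (by have : (0 : ℝ) ≤ k := k.cast_nonneg
        linarith) one_pos hr
  refine h.congr_fun (fun t ht => ?_) measurableSet_Ioi
  simp

lemma integrableOn_pow_mul_cexp_neg_mul (k : ℕ) {r : ℂ} (hr : 0 < r.re) :
    MeasureTheory.IntegrableOn (fun t : ℝ => (t : ℂ) ^ k * Complex.exp (-(r * t)))
      (Set.Ioi 0) := by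
  refine MeasureTheory.Integrable.mono' (integrableOn_pow_mul_exp_neg_mul k hr)
    (Continuous.aestronglyMeasurable (by fun_prop)) ?_
  refine (MeasureTheory.ae_restrict_iff' measurableSet_Ioi).2 (MeasureTheory.ae_of_all _ fun t ht => ?_)
  simp [Complex.norm_exp, abs_of_pos (Set.mem_Ioi.1 ht)]

lemma integral_pow_mul_cexp_neg_mul (k : ℕ) {r : ℂ} (hr : 0 < r.re) :
    ∫ t in Set.Ioi (0 : ℝ), (t : ℂ) ^ k * Complex.exp (-(r * t)) =
      (k.factorial : ℂ) / r ^ (k + 1) := by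
  have hr0 : r ≠ 0 := fun h => by simp [h] at hr
  induction k with
  | zero =>
    have := integral_exp_mul_complex_Ioi (a := -r) (by simpa using hr) 0
    simp only [neg_mul] at this
    simp only [pow_zero, one_mul, this]
    simp
  | succ k ih =>
    have hd : ∀ t : ℝ, HasDerivAt (fun t : ℝ => -((t : ℂ) ^ (k + 1) * Complex.exp (-(r * t))) / r)
        ((t : ℂ) ^ (k + 1) * Complex.exp (-(r * t)) -
          ((k + 1) / r) * ((t : ℂ) ^ k * Complex.exp (-(r * t)))) t := by
      intro t
      have h1 : HasDerivAt (fun t : ℝ => (t : ℂ)) 1 t := Complex.ofRealCLM.hasDerivAt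
      have h2 : HasDerivAt (fun t : ℝ => (t : ℂ) ^ (k + 1) * Complex.exp (-(r * t)))
          ((((k + 1 : ℕ) : ℂ) * (t : ℂ) ^ (k + 1 - 1) * 1) * Complex.exp (-(r * t)) +
            (t : ℂ) ^ (k + 1) * (Complex.exp (-(r * t)) * -(r * 1))) t :=
        (h1.pow (k + 1)).mul ((h1.const_mul r).neg.cexp)
      convert! (h2.neg.div_const r) using 1
      simp only [Nat.add_sub_cancel]
      push_cast
      field_simp
      ring
    have hi1 := integrableOn_pow_mul_cexp_neg_mul (k + 1) hr
    have hi2 := (integrableOn_pow_mul_cexp_neg_mul k hr).const_mul ((k + 1) / r)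
    have hT := ((tendsto_pow_mul_cexp_neg_mul_atTop (k + 1) hr).neg).div_const r
    have h := MeasureTheory.integral_Ioi_of_hasDerivAt_of_tendsto'
      (a := 0) (fun t _ => hd t) (hi1.sub hi2) hT
    rw [MeasureTheory.integral_sub hi1 hi2, MeasureTheory.integral_const_mul, ih] at h
    rw [sub_eq_iff_eq_add.1 h, Nat.factorial_succ]
    simp only [Complex.ofReal_zero]
    push_cast
    field_simp
    simp [pow_succ]
    ring

/-! ### The zeta kernel: partial fractions and Mellin transform. -/

/-- The function `1 / (e ^ t - 1) + 1 / 2 - 1 / t`. -/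
noncomputable def zetaKernel (t : ℝ) : ℝ := 1 / (Real.exp t - 1) + 1 / 2 - 1 / t

/-- This is the Mittag-Leffler expansion of π cot(πx) at the imaginary point x = it/(2π), divided by
-2πi. -/
lemma hasSum_zetaKernel {t : ℝ} (ht : 0 < t) :
    HasSum (fun j : ℕ => 2 * t / (t ^ 2 + (2 * Real.pi * (j + 1)) ^ 2)) (zetaKernel t) := by
  have hpi := Real.pi_pos
  have hpi0 : (Real.pi : ℂ) ≠ 0 := by exact_mod_cast hpi.ne'
  have ht0 : (t : ℂ) ≠ 0 := by exact_mod_cast ht.ne'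
  set x : ℂ := Complex.I * t / (2 * Real.pi) with hx
  have hxi : x = ((t / (2 * Real.pi) : ℝ) : ℂ) * Complex.I := by
    rw [hx]; push_cast; ring
  have him : x.im = t / (2 * Real.pi) := by
    rw [hxi, Complex.im_ofReal_mul]; simp
  have hxm : x ∈ Complex.integerComplement := by
    rintro ⟨m, hm⟩
    have : x.im = 0 := by rw [← hm]; simp
    rw [him] at this
    have : 0 < t / (2 * Real.pi) := by positivity
    linarith
  have h1 := cot_series_rep' hxm
  have h2 := summable_cotTerm hxm
  have h3 : HasSum (fun j : ℕ => 1 / (x - (j + 1)) + 1 / (x + (j + 1)))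
      (Real.pi * (Real.pi * x).cot - 1 / x) := by
    rw [h1]; exact h2.hasSum
  have h4 := h3.mul_left (-(2 * Real.pi * Complex.I))⁻¹
  rw [← Complex.hasSum_ofReal]
  convert! h4 using 1
  · funext j
    have hj : (0 : ℝ) < t ^ 2 + (2 * Real.pi * (j + 1)) ^ 2 := by positivity
    have hj' : (t : ℂ) ^ 2 + (2 * Real.pi * (j + 1)) ^ 2 ≠ 0 := by exact_mod_cast hj.ne'
    have hI := Complex.I_sq
    have e1 : x - (j + 1) ≠ 0 := by
      intro h
      have := congrArg Complex.im h
      simp [him] at this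
      exact absurd this ht.ne'
    have e2 : x + (j + 1) ≠ 0 := by
      intro h
      have := congrArg Complex.im h
      simp [him] at this
      exact absurd this ht.ne'
    have e3 : (x - (j + 1)) * (x + (j + 1)) =
        -((t : ℂ) ^ 2 + (2 * Real.pi * (j + 1)) ^ 2) / (2 * Real.pi) ^ 2 := by
      rw [hx]; field_simp; linear_combination (t : ℂ) ^ 2 * hI
    rw [div_add_div _ _ e1 e2, e3]
    push_cast
    rw [hx]
    field_simp
    ring
  · have hE : Complex.exp (2 * Real.pi * Complex.I * x) = (Complex.exp t)⁻¹ := by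
      rw [← Complex.exp_neg, hx]
      congr 1
      field_simp
      linear_combination  Complex.I_sq
    have hE1 : Complex.exp t - 1 ≠ 0 := by
      have := Real.add_one_lt_exp ht.ne'
      exact_mod_cast (by linarith : Real.exp t - 1 ≠ 0)
    have hE0 := Complex.exp_ne_zero t
    rw [Complex.cot_pi_eq_exp_ratio, hE, zetaKernel, hx]
    have hE3 : 1 - (Complex.exp t)⁻¹ = (Complex.exp t - 1) / Complex.exp t := by
      field_simp
    have hE4 : (Complex.exp t)⁻¹ + 1 = (Complex.exp t + 1) / Complex.exp t := by
      field_simp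
      ring
    rw [hE3, hE4]
    push_cast
    generalize Complex.exp t = E at *
    field_simp
    ring_nf
    simp only [Complex.I_sq]
    ring_nf

lemma zetaKernel_nonneg {t : ℝ} (ht : 0 < t) : 0 ≤ zetaKernel t :=
  (hasSum_zetaKernel ht).nonneg fun j => by positivity

lemma zetaKernel_le_half {t : ℝ} (ht : 0 < t) : zetaKernel t ≤ 1 / 2 := by
  have h := Real.add_one_le_exp t
  have : 1 / (Real.exp t - 1) ≤ 1 / t := one_div_le_one_div_of_le ht (by linarith)
  rw [zetaKernel]
  linarith

/-- The function whose Mellin transform is `Γ(s) (ζ(s) - 1 / (s - 1) - 1 / 2)`. -/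
noncomputable def dampedKernel (t : ℝ) : ℂ := (Real.exp (-t) * zetaKernel t : ℝ)

lemma norm_dampedKernel_le {t : ℝ} (ht : 0 < t) : ‖dampedKernel t‖ ≤ Real.exp (-t) := by
  rw [dampedKernel, Complex.norm_real, Real.norm_eq_abs, abs_mul, Real.abs_exp,
    abs_of_nonneg (zetaKernel_nonneg ht)]
  have := zetaKernel_le_half ht
  have := Real.exp_pos (-t)
  nlinarith

lemma continuousOn_dampedKernel : ContinuousOn dampedKernel (Set.Ioi 0) := by
  unfold dampedKernel zetaKernel
  refine Complex.continuous_ofReal.comp_continuousOn ?_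
  have h1 : ∀ x ∈ Set.Ioi (0 : ℝ), Real.exp x - 1 ≠ 0 := by
    intro x hx
    have := Real.add_one_lt_exp (ne_of_gt (Set.mem_Ioi.1 hx))
    have := Set.mem_Ioi.1 hx
    linarith
  have h2 : ∀ x ∈ Set.Ioi (0 : ℝ), x ≠ 0 := fun x hx => ne_of_gt (Set.mem_Ioi.1 hx)
  fun_prop (disch := assumption)

lemma dampedKernel_isBigO_rpow (a : ℝ) :
    dampedKernel =O[atTop] fun x : ℝ => x ^ (-a) := by
  refine IsBigO.trans (g := fun x => Real.exp (-x)) ?_ ?_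
  · refine IsBigO.of_bound 1 ?_
    filter_upwards [eventually_gt_atTop 0] with t ht
    simpa using norm_dampedKernel_le ht
  · simpa using (isLittleO_exp_neg_mul_rpow_atTop one_pos (-a)).isBigO

lemma dampedKernel_isBigO_zero :
    dampedKernel =O[𝓝[>] 0] fun x : ℝ => x ^ (-0 : ℝ) := by
  refine IsBigO.of_bound 1 ?_
  filter_upwards [self_mem_nhdsWithin] with t ht
  have := Real.exp_le_one_iff.2 (neg_nonpos.2 (le_of_lt (Set.mem_Ioi.1 ht)))
  simpa using (norm_dampedKernel_le ht).trans this

lemma mellinConvergent_dampedKernel {s : ℂ} (hs : 0 < s.re) : MellinConvergent dampedKernel s :=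
  mellinConvergent_of_isBigO_rpow
    (continuousOn_dampedKernel.locallyIntegrableOn measurableSet_Ioi)
    (dampedKernel_isBigO_rpow (s.re + 1)) (by linarith) dampedKernel_isBigO_zero hs

lemma continuousAt_mellin_dampedKernel {s : ℂ} (hs : 0 < s.re) :
    ContinuousAt (mellin dampedKernel) s :=
  (mellin_differentiableAt_of_isBigO_rpow
    (continuousOn_dampedKernel.locallyIntegrableOn measurableSet_Ioi)
    (dampedKernel_isBigO_rpow (s.re + 1)) (by linarith) dampedKernel_isBigO_zero hs).continuousAt

lemma hasMellin_cexp_neg {s : ℂ} (hs : 0 < s.re) :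
    HasMellin (fun t : ℝ => ((Real.exp (-t) : ℝ) : ℂ)) s (Complex.Gamma s) := by
  constructor
  · have := Complex.GammaIntegral_convergent hs
    refine this.congr_fun (fun t _ => ?_) measurableSet_Ioi
    simp [mul_comm]
  · rw [Complex.Gamma_eq_integral hs, Complex.GammaIntegral, mellin]
    refine MeasureTheory.setIntegral_congr_fun measurableSet_Ioi fun t _ => ?_
    simp [mul_comm]

lemma mellin_one_div_exp_sub_one {s : ℂ} (hs : 1 < s.re) :
    mellin (fun t : ℝ => ((1 / (Real.exp t - 1) : ℝ) : ℂ)) s =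
      Complex.Gamma s * riemannZeta s := by
  have h := hasSum_mellin (ι := ℕ) (a := fun _ => 1) (p := fun j => (j : ℝ) + 1)
    (F := fun t : ℝ => ((1 / (Real.exp t - 1) : ℝ) : ℂ)) (s := s)
    (fun j => Or.inr (by positivity)) (by linarith) ?_ ?_
  · rw [← h.tsum_eq, zeta_eq_tsum_one_div_nat_add_one_cpow hs, ← tsum_mul_left]
    refine tsum_congr fun j => ?_
    push_cast
    rw [mul_div_assoc]
  · intro t ht
    have ht : 0 < t := ht
    have hr : Real.exp (-t) < 1 := by simpa using ht
    have h1 := (hasSum_geometric_of_lt_one (Real.exp_pos (-t)).le hr).mul_left (Real.exp (-t))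
    have h2 : Real.exp (-t) * (1 - Real.exp (-t))⁻¹ = 1 / (Real.exp t - 1) := by
      have h3 := Real.add_one_lt_exp ht.ne'
      have h4 : Real.exp t - 1 ≠ 0 := by linarith
      have h5 : 1 - Real.exp (-t) = (Real.exp t - 1) / Real.exp t := by
        rw [Real.exp_neg]; field_simp
      rw [h5, Real.exp_neg]
      field_simp
    rw [h2, ← Complex.hasSum_ofReal] at h1
    convert! h1 using 2 with j
    rw [one_mul, ← Real.exp_nat_mul, ← Real.exp_add]
    congr 2
    ring
  · have := (summable_nat_add_iff 1).2 (Real.summable_one_div_nat_rpow.2 hs)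
    simpa using this

/-- Since e^{-t}/(e^t-1) = 1/(e^t-1) - e^{-t}, the damped kernel is 1/(e^t-1) - e^{-t}/t - e^{-t}/2.
The three transforms are Γ(s)ζ(s), Γ(s-1) = Γ(s)/(s-1) and Γ(s)/2. -/
lemma mellin_dampedKernel {s : ℂ} (hs : 1 < s.re) :
    mellin dampedKernel s =
      Complex.Gamma s * (riemannZeta s - 1 / (s - 1) - 1 / 2) := by
  have h1 := hasMellin_cexp_neg (s := s) (by linarith)
  have h2 := hasMellin_cexp_neg (s := s - 1) (by simpa using hs)
  have h3 : HasMellin (fun t : ℝ => (t : ℂ) ^ (-1 : ℂ) • ((Real.exp (-t) : ℝ) : ℂ)) s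
      (Complex.Gamma (s - 1)) := by
    constructor
    · rw [MellinConvergent.cpow_smul, ← sub_eq_add_neg]; exact h2.1
    · rw [mellin_cpow_smul, ← sub_eq_add_neg]; exact h2.2
  have h4 : HasMellin dampedKernel s (mellin dampedKernel s) :=
    ⟨mellinConvergent_dampedKernel (by linarith), rfl⟩
  have h5 := hasMellin_add (hasMellin_add h4.1 h3.1).1 (h1.1.const_smul (1 / 2 : ℂ))
  rw [(hasMellin_add h4.1 h3.1).2, mellin_const_smul, h1.2, h3.2] at h5
  have h6 := mellin_one_div_exp_sub_one hs
  have h7 : mellin (fun t : ℝ => ((1 / (Real.exp t - 1) : ℝ) : ℂ)) s =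
      mellin (fun t => dampedKernel t + (t : ℂ) ^ (-1 : ℂ) • ((Real.exp (-t) : ℝ) : ℂ) +
        (1 / 2 : ℂ) • ((Real.exp (-t) : ℝ) : ℂ)) s := by
    refine MeasureTheory.setIntegral_congr_fun measurableSet_Ioi fun t ht => ?_
    have ht : 0 < t := ht
    have h8 := Real.add_one_lt_exp ht.ne'
    have h9 : Real.exp t - 1 ≠ 0 := by linarith
    congr 1
    simp only
    rw [dampedKernel, zetaKernel, Complex.cpow_neg_one, smul_eq_mul, smul_eq_mul]
    norm_cast
    push_cast
    rw [show (1 / 2 : ℂ) = ((1 / 2 : ℝ) : ℂ) by push_cast; rfl]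
    norm_cast
    rw [Real.exp_neg]
    field_simp
    ring
  rw [h7, h5.2] at h6
  have h8 : Complex.Gamma s = (s - 1) * Complex.Gamma (s - 1) := by
    have := Complex.Gamma_add_one (s - 1) (by
      intro h
      have := congrArg Complex.re h
      simp at this
      linarith)
    rwa [sub_add_cancel] at this
  have h9 : s - 1 ≠ 0 := by
    intro h
    have := congrArg Complex.re h
    simp at this
    linarith
  have h10 : Complex.Gamma (s - 1) = Complex.Gamma s * (1 / (s - 1)) := by
    rw [h8]; field_simp
  rw [smul_eq_mul, h10] at h6
  linear_combination h6

/-- The formula for Re s > 1 extends to s = 1 by letting s → 1 in that half-plane: the transform is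
continuous there and ζ(s) - 1/(s-1) → γ. -/
lemma mellin_dampedKernel_one :
    mellin dampedKernel 1 = Real.eulerMascheroniConstant - 1 / 2 := by
  set U : Set ℂ := {s | 1 < s.re}
  have hne : (𝓝[U] (1 : ℂ)).NeBot := by
    rw [← mem_closure_iff_nhdsWithin_neBot, Metric.mem_closure_iff]
    intro ε hε
    refine ⟨1 + (ε / 2 : ℝ), ?_, ?_⟩
    · simp [U, hε]
    · rw [dist_eq_norm, sub_add_cancel_left, norm_neg, Complex.norm_real, Real.norm_eq_abs,
        abs_of_pos (by positivity)]
      linarith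
  have hle : 𝓝[U] (1 : ℂ) ≤ 𝓝[≠] 1 := nhdsWithin_mono _ fun s hs h => by
    change 1 < s.re at hs
    rw [Set.mem_singleton_iff.1 h] at hs
    simp at hs
  have h1 : Tendsto (mellin dampedKernel) (𝓝[U] 1) (𝓝 (mellin dampedKernel 1)) :=
    (continuousAt_mellin_dampedKernel (by simp)).tendsto.mono_left nhdsWithin_le_nhds
  have h2 : Tendsto Complex.Gamma (𝓝[U] 1) (𝓝 (Complex.Gamma 1)) :=
    (Complex.differentiableAt_Gamma_one.continuousAt).tendsto.mono_left nhdsWithin_le_nhds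
  have h3 := h2.mul ((tendsto_riemannZeta_sub_one_div.mono_left hle).sub_const (1 / 2))
  rw [Complex.Gamma_one, one_mul] at h3
  refine tendsto_nhds_unique h1 (h3.congr' ?_)
  filter_upwards [self_mem_nhdsWithin] with s hs
  exact (mellin_dampedKernel hs).symm

lemma integral_pow_mul_dampedKernel (k : ℕ) :
    ∫ t in Set.Ioi (0 : ℝ), (t : ℂ) ^ k * dampedKernel t =
      k.factorial * (regZeta (k + 1) - 1 / 2) := by
  have h : mellin dampedKernel (k + 1) = k.factorial * (regZeta (k + 1) - 1 / 2) := by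
    rcases Nat.eq_zero_or_pos k with rfl | hk
    · simp [mellin_dampedKernel_one, regZeta_one]
    · rw [mellin_dampedKernel (by simpa using hk), Complex.Gamma_nat_eq_factorial,
        regZeta_of_ne_one (by simpa using hk.ne')]
  rw [← h]
  refine MeasureTheory.setIntegral_congr_fun measurableSet_Ioi fun t _ => ?_
  simp

/-! ### Integrals along the ray of argument -π/4. -/

/-- The primitive eighth root of unity `e ^ (i π / 4)`. -/
noncomputable def eighthRoot : ℂ := ⟨√2 / 2, √2 / 2⟩

/-- The primitive eighth root of unity `e ^ (-i π / 4)`. -/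
noncomputable def eighthRootConj : ℂ := ⟨√2 / 2, -(√2 / 2)⟩

local notation "σ" => eighthRoot
local notation "τ" => eighthRootConj

lemma sqrt_two_mul_self : √2 * √2 = 2 := Real.mul_self_sqrt (by norm_num)

@[simp] lemma eighthRoot_re : (σ).re = √2 / 2 := rfl
@[simp] lemma eighthRoot_im : (σ).im = √2 / 2 := rfl
@[simp] lemma eighthRootConj_re : (τ).re = √2 / 2 := rfl
@[simp] lemma eighthRootConj_im : (τ).im = -(√2 / 2) := rfl

lemma eighthRoot_mul_conj : σ * τ = 1 := by
  have := sqrt_two_mul_self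
  apply Complex.ext <;> simp <;> linarith

lemma eighthRoot_sq : σ ^ 2 = Complex.I := by
  have := sqrt_two_mul_self
  rw [sq]
  apply Complex.ext <;> simp <;> linarith

lemma I_mul_eighthRootConj : Complex.I * τ = σ := by
  apply Complex.ext <;> simp

lemma norm_eighthRoot : ‖σ‖ = 1 := by
  have := sqrt_two_mul_self
  rw [Complex.norm_eq_sqrt_sq_add_sq, Real.sqrt_eq_one]
  simp only [eighthRoot_re, eighthRoot_im]
  nlinarith

lemma norm_eighthRootConj : ‖τ‖ = 1 := by
  have := sqrt_two_mul_self
  rw [Complex.norm_eq_sqrt_sq_add_sq, Real.sqrt_eq_one]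
  simp only [eighthRootConj_re, eighthRootConj_im]
  nlinarith

lemma one_le_norm_one_add_eighthRootConj_mul {s : ℝ} (hs : 0 < s) : 1 ≤ ‖1 + τ * s‖ := by
  refine le_trans ?_ (Complex.re_le_norm _)
  simp
  positivity

lemma one_add_eighthRootConj_mul_ne_zero {s : ℝ} (hs : 0 < s) : 1 + τ * s ≠ 0 := by
  rw [← norm_pos_iff]
  exact one_pos.trans_le (one_le_norm_one_add_eighthRootConj_mul hs)

lemma norm_cexp_neg_eighthRoot (a s : ℝ) :
    ‖Complex.exp (-(a * σ * s))‖ = Real.exp (-(a * (√2 / 2) * s)) := by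
  simp [Complex.norm_exp]

lemma integrableOn_exp_neg_mul {r : ℝ} (hr : 0 < r) :
    MeasureTheory.IntegrableOn (fun t : ℝ => Real.exp (-(r * t))) (Set.Ioi 0) := by
  simpa using integrableOn_pow_mul_exp_neg_mul 0 hr

lemma integrableOn_cexp_eighthRoot_mul {a : ℝ} (ha : 0 < a) {f : ℝ → ℂ}
    (hf : ContinuousOn f (Set.Ioi 0)) (hb : ∀ s, 0 < s → ‖f s‖ ≤ 1) :
    MeasureTheory.IntegrableOn (fun s : ℝ => Complex.exp (-(a * σ * s)) * f s) (Set.Ioi 0) := by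
  have h := integrableOn_exp_neg_mul (r := a * (√2 / 2)) (by positivity)
  refine MeasureTheory.Integrable.mono' h ?_ ?_
  · refine ContinuousOn.aestronglyMeasurable ?_ measurableSet_Ioi
    fun_prop
  · refine (MeasureTheory.ae_restrict_iff' measurableSet_Ioi).2
      (MeasureTheory.ae_of_all _ fun t ht => ?_)
    rw [norm_mul, norm_cexp_neg_eighthRoot]
    exact mul_le_of_le_one_right (Real.exp_pos _).le (hb t ht)

/-- `∫ e ^ (-i a u) (1 + u) ^ (-k) du` along the ray of argument `-π / 4`. -/
noncomputable def rayIntegral (a : ℝ) (k : ℕ) : ℂ :=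
  τ * ∫ s in Set.Ioi (0 : ℝ), Complex.exp (-(a * σ * s)) * (1 / (1 + τ * s)) ^ k

lemma integrableOn_rayIntegral {a : ℝ} (ha : 0 < a) (k : ℕ) :
    MeasureTheory.IntegrableOn
      (fun s : ℝ => Complex.exp (-(a * σ * s)) * (1 / (1 + τ * s)) ^ k) (Set.Ioi 0) := by
  refine integrableOn_cexp_eighthRoot_mul ha ?_ ?_
  · refine ContinuousOn.pow (ContinuousOn.div (by fun_prop) (by fun_prop) ?_) k
    exact fun x hx => one_add_eighthRootConj_mul_ne_zero hx
  · intro s hs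
    rw [norm_pow, norm_div, norm_one]
    exact pow_le_one₀ (by positivity)
      ((div_le_one (by linarith [one_le_norm_one_add_eighthRootConj_mul hs])).2
        (one_le_norm_one_add_eighthRootConj_mul hs))

/-- For k = 0 the integral is 1/(ia), which is purely imaginary. This matches φ(0) - 1/2 = 0 and
covers the one index that the Mellin transform does not reach. -/
lemma rayIntegral_zero_add_conj {a : ℝ} (ha : 0 < a) :
    rayIntegral a 0 + starRingEnd ℂ (rayIntegral a 0) = 0 := by
  have ha' : (a : ℂ) ≠ 0 := by exact_mod_cast ha.ne'
  have h := integral_pow_mul_cexp_neg_mul 0 (r := a * σ) (by simp; positivity)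
  simp only [pow_zero, one_mul, Nat.factorial_zero, zero_add, pow_one] at h
  have h2 : rayIntegral a 0 = -(((1 / a : ℝ) : ℂ) * Complex.I) := by
    have h3 : σ ≠ 0 := left_ne_zero_of_mul_eq_one eighthRoot_mul_conj
    simp only [rayIntegral, pow_zero, mul_one]
    rw [h]
    push_cast
    field_simp
    rw [← I_mul_eighthRootConj, mul_comm Complex.I τ, mul_assoc, Complex.I_mul_I]
    ring
  rw [h2, map_neg, map_mul, Complex.conj_ofReal, Complex.conj_I]
  ring

/-- Write 1/(t+ia) as τ∫ e^{-(tτ+aσ)s} ds, using tτ + aσ = τ(t+ia), and apply Fubini. The direction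
-π/4 gives both tτ and aσ positive real part, which makes the double integral absolutely convergent.
-/
lemma integral_pow_mul_exp_neg_div_eq_rayIntegral {a : ℝ} (ha : 0 < a) (k : ℕ) :
    ∫ t in Set.Ioi (0 : ℝ), (t : ℂ) ^ k * Complex.exp (-t) / (t + Complex.I * a) =
      k.factorial * rayIntegral a (k + 1) := by
  set G : ℝ → ℝ → ℂ := fun t s =>
    (t : ℂ) ^ k * Complex.exp (-t) * Complex.exp (-((t * τ + a * σ) * s)) with hG
  have hint : MeasureTheory.Integrable (Function.uncurry G)
      ((MeasureTheory.volume.restrict (Set.Ioi 0)).prod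
        (MeasureTheory.volume.restrict (Set.Ioi 0))) := by
    have h := (integrableOn_pow_mul_exp_neg_mul k one_pos).mul_prod
      (integrableOn_exp_neg_mul (r := a * (√2 / 2)) (by positivity))
    refine MeasureTheory.Integrable.mono' h
      (Continuous.aestronglyMeasurable (by rw [hG]; unfold Function.uncurry; fun_prop)) ?_
    rw [MeasureTheory.Measure.prod_restrict]
    refine (MeasureTheory.ae_restrict_iff' (measurableSet_Ioi.prod measurableSet_Ioi)).2
      (MeasureTheory.ae_of_all _ fun p hp => ?_)
    obtain ⟨t, s⟩ := p
    have ht : 0 < t := hp.1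
    have hs : 0 < s := hp.2
    simp only [hG, Function.uncurry]
    rw [norm_mul, norm_mul, norm_pow, Complex.norm_real, Complex.norm_exp, Complex.norm_exp,
      Real.norm_eq_abs, abs_of_pos ht]
    simp only [Complex.neg_re, Complex.ofReal_re, Complex.mul_re, Complex.add_re, Complex.ofReal_im,
      eighthRoot_re, eighthRootConj_re, zero_mul, sub_zero, one_mul, mul_zero]
    refine mul_le_mul_of_nonneg_left (Real.exp_le_exp.2 ?_) (by positivity)
    have : 0 ≤ t * (√2 / 2) * s := by positivity
    nlinarith
  have hswap := MeasureTheory.integral_integral_swap hint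
  have h1 : ∀ t ∈ Set.Ioi (0 : ℝ), (t : ℂ) ^ k * Complex.exp (-t) / (t + Complex.I * a) =
      τ * ∫ s in Set.Ioi (0 : ℝ), G t s := by
    intro t ht
    have ht : 0 < t := ht
    have hre : 0 < ((t : ℂ) * τ + a * σ).re := by
      simp
      positivity
    have h := integral_pow_mul_cexp_neg_mul 0 hre
    simp only [pow_zero, one_mul, Nat.factorial_zero, zero_add, pow_one] at h
    have hne : (t : ℂ) * τ + a * σ ≠ 0 := fun h => by rw [h] at hre; simp at hre
    have heq : (t : ℂ) * τ + a * σ = τ * (t + Complex.I * a) := by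
      rw [← I_mul_eighthRootConj]; ring
    rw [heq] at hne
    have hne1 := left_ne_zero_of_mul hne
    have hne2 := right_ne_zero_of_mul hne
    simp only [hG]
    rw [MeasureTheory.integral_const_mul, h, heq]
    field_simp
    simp
  have h2 : ∀ s ∈ Set.Ioi (0 : ℝ), ∫ t in Set.Ioi (0 : ℝ), G t s =
      k.factorial * (Complex.exp (-(a * σ * s)) * (1 / (1 + τ * s)) ^ (k + 1)) := by
    intro s hs
    have hs : 0 < s := hs
    have hre : 0 < (1 + τ * s).re := by
      simp
      positivity
    have h := integral_pow_mul_cexp_neg_mul k hre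
    have h3 : ∀ t : ℝ, G t s = Complex.exp (-(a * σ * s)) *
        ((t : ℂ) ^ k * Complex.exp (-((1 + τ * s) * t))) := by
      intro t
      simp only [hG]
      rw [mul_assoc, ← Complex.exp_add, mul_left_comm, ← Complex.exp_add]
      congr 2
      ring
    simp only [h3]
    rw [MeasureTheory.integral_const_mul, h]
    rw [one_div, inv_pow]
    ring
  rw [MeasureTheory.setIntegral_congr_fun measurableSet_Ioi h1, MeasureTheory.integral_const_mul,
    hswap, MeasureTheory.setIntegral_congr_fun measurableSet_Ioi h2,
    MeasureTheory.integral_const_mul, rayIntegral]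
  ring

lemma integrableOn_pow_mul_exp_neg_div {a : ℝ} (ha : 0 < a) (k : ℕ) :
    MeasureTheory.IntegrableOn
      (fun t : ℝ => (t : ℂ) ^ k * Complex.exp (-t) / (t + Complex.I * a)) (Set.Ioi 0) := by
  have h := (integrableOn_pow_mul_exp_neg_mul k one_pos).mul_const (1 / a)
  have hne : ∀ t : ℝ, (t + Complex.I * a : ℂ) ≠ 0 := by
    intro t h
    have := congrArg Complex.im h
    simp at this
    exact ha.ne' this
  refine MeasureTheory.Integrable.mono' h
    (Continuous.aestronglyMeasurable (by fun_prop (disch := assumption))) ?_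
  refine (MeasureTheory.ae_restrict_iff' measurableSet_Ioi).2
    (MeasureTheory.ae_of_all _ fun t ht => ?_)
  have ht : 0 < t := ht
  rw [norm_div, norm_mul, norm_pow, Complex.norm_real, Complex.norm_exp, Real.norm_eq_abs,
    abs_of_pos ht, div_eq_mul_one_div]
  simp only [Complex.neg_re, Complex.ofReal_re, one_mul]
  refine mul_le_mul_of_nonneg_left (one_div_le_one_div_of_le ha ?_) (by positivity)
  refine le_trans ?_ (Complex.abs_im_le_norm _)
  simp [abs_of_pos ha]

lemma two_mul_div_sq_add_sq_eq {a : ℝ} (ha : 0 < a) (k : ℕ) (t : ℝ) :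
    ((t ^ k * (Real.exp (-t) * (2 * t / (t ^ 2 + a ^ 2))) : ℝ) : ℂ) =
      (t : ℂ) ^ k * Complex.exp (-t) / (t + Complex.I * a) +
        starRingEnd ℂ ((t : ℂ) ^ k * Complex.exp (-t) / (t + Complex.I * a)) := by
  have h1 : (t + Complex.I * a : ℂ) ≠ 0 := by
    intro h
    have := congrArg Complex.im h
    simp at this
    exact ha.ne' this
  have h2 : (t + -Complex.I * a : ℂ) ≠ 0 := by
    intro h
    have := congrArg Complex.im h
    simp at this
    exact ha.ne' this
  have h3 : (t + Complex.I * a : ℂ) * (t + -Complex.I * a) = t ^ 2 + a ^ 2 := by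
    linear_combination -(a : ℂ) ^ 2 * Complex.I_sq
  have h4 : ((t : ℂ) ^ 2 + a ^ 2) ≠ 0 := h3 ▸ mul_ne_zero h1 h2
  simp only [map_div₀, map_mul, map_pow, map_add, Complex.conj_ofReal, Complex.conj_I,
    ← Complex.exp_conj, map_neg]
  rw [div_add_div _ _ h1 h2, h3]
  push_cast
  field_simp
  ring

lemma integral_pow_mul_exp_neg_mul_div_sq_add_sq {a : ℝ} (ha : 0 < a) (k : ℕ) :
    ∫ t in Set.Ioi (0 : ℝ), ((t ^ k * (Real.exp (-t) * (2 * t / (t ^ 2 + a ^ 2))) : ℝ) : ℂ) =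
      k.factorial * (rayIntegral a (k + 1) + starRingEnd ℂ (rayIntegral a (k + 1))) := by
  have hi := integrableOn_pow_mul_exp_neg_div ha k
  have hi' : MeasureTheory.IntegrableOn (fun t : ℝ =>
      starRingEnd ℂ ((t : ℂ) ^ k * Complex.exp (-t) / (t + Complex.I * a))) (Set.Ioi 0) :=
    Complex.conjCLE.toContinuousLinearMap.integrable_comp hi
  simp only [two_mul_div_sq_add_sq_eq ha]
  rw [MeasureTheory.integral_add hi hi', integral_conj,
    integral_pow_mul_exp_neg_div_eq_rayIntegral ha, map_mul, Complex.conj_natCast]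
  ring

/-- Termwise integration of the partial fractions against t^k e^{-t}. The j-th integrand is at most
2t^{k+1}e^{-t}/(2π(j+1))², so the integrals of the norms are summable. -/
lemma hasSum_rayIntegral_succ (k : ℕ) :
    HasSum (fun j : ℕ => rayIntegral (2 * Real.pi * (j + 1)) (k + 1) +
      starRingEnd ℂ (rayIntegral (2 * Real.pi * (j + 1)) (k + 1))) (regZeta (k + 1) - 1 / 2) := by
  have hpi := Real.pi_pos
  have ha : ∀ j : ℕ, 0 < 2 * Real.pi * ((j : ℝ) + 1) := fun j => by positivity
  set F : ℕ → ℝ → ℂ := fun j t =>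
    ((t ^ k * (Real.exp (-t) * (2 * t / (t ^ 2 + (2 * Real.pi * (j + 1)) ^ 2))) : ℝ) : ℂ) with hF
  have hI : ∀ j, MeasureTheory.IntegrableOn (F j) (Set.Ioi 0) := by
    intro j
    have hi := integrableOn_pow_mul_exp_neg_div (ha j) k
    simp only [hF, two_mul_div_sq_add_sq_eq (ha j)]
    exact hi.add (Complex.conjCLE.toContinuousLinearMap.integrable_comp hi)
  have hS : Summable fun j => ∫ t in Set.Ioi (0 : ℝ), ‖F j t‖ := by
    have h0 := integrableOn_pow_mul_exp_neg_mul (k + 1) one_pos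
    have h1 : Summable fun j : ℕ => (∫ t in Set.Ioi (0 : ℝ), t ^ (k + 1) * Real.exp (-(1 * t))) *
        (2 / (2 * Real.pi) ^ 2) * (1 / ((j : ℝ) + 1) ^ 2) := by
      have := (summable_nat_add_iff 1).2 (Real.summable_one_div_nat_pow.2 one_lt_two)
      refine Summable.mul_left _ ?_
      simpa using this
    refine Summable.of_nonneg_of_le (fun j => MeasureTheory.integral_nonneg fun t => norm_nonneg _)
      (fun j => ?_) h1
    rw [mul_assoc, ← MeasureTheory.integral_mul_const]
    refine MeasureTheory.setIntegral_mono_on (hI j).norm (h0.mul_const _) measurableSet_Ioi ?_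
    intro t ht
    have ht : 0 < t := ht
    simp only [hF]
    have h5 : 0 ≤ t ^ k * (Real.exp (-t) * (2 * t / (t ^ 2 + (2 * Real.pi * (j + 1)) ^ 2))) := by
      positivity
    rw [Complex.norm_real, Real.norm_of_nonneg h5]
    have h6 : 2 * t / (t ^ 2 + (2 * Real.pi * (j + 1)) ^ 2) ≤
        2 * t / (2 * Real.pi * (j + 1)) ^ 2 :=
      div_le_div_of_nonneg_left (by positivity) (by have := ha j; positivity)
        (by nlinarith [sq_nonneg t])
    calc t ^ k * (Real.exp (-t) * (2 * t / (t ^ 2 + (2 * Real.pi * (j + 1)) ^ 2)))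
        ≤ t ^ k * (Real.exp (-t) * (2 * t / (2 * Real.pi * (j + 1)) ^ 2)) := by gcongr
      _ = t ^ (k + 1) * Real.exp (-(1 * t)) *
          (2 / (2 * Real.pi) ^ 2 * (1 / ((j : ℝ) + 1) ^ 2)) := by
        rw [one_mul, mul_pow]
        field_simp
        ring
  have h := MeasureTheory.hasSum_integral_of_summable_integral_norm hI hS
  have h2 : ∫ t in Set.Ioi (0 : ℝ), ∑' j, F j t = k.factorial * (regZeta (k + 1) - 1 / 2) := by
    rw [← integral_pow_mul_dampedKernel]
    refine MeasureTheory.setIntegral_congr_fun measurableSet_Ioi fun t ht => ?_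
    have h3 := ((hasSum_zetaKernel ht).mul_left (Real.exp (-t))).mul_left (t ^ k)
    rw [← Complex.hasSum_ofReal] at h3
    simp only [hF]
    rw [h3.tsum_eq, dampedKernel]
    push_cast
    rfl
  rw [h2] at h
  have hk : (k.factorial : ℂ) ≠ 0 := by exact_mod_cast k.factorial_ne_zero
  have h4 := h.mul_left (k.factorial : ℂ)⁻¹
  rw [inv_mul_cancel_left₀ hk] at h4
  convert! h4 using 2 with j
  simp only [hF]
  rw [integral_pow_mul_exp_neg_mul_div_sq_add_sq (ha j), inv_mul_cancel_left₀ hk]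

lemma hasSum_rayIntegral (k : ℕ) :
    HasSum (fun j : ℕ => rayIntegral (2 * Real.pi * (j + 1)) k +
      starRingEnd ℂ (rayIntegral (2 * Real.pi * (j + 1)) k)) (regZeta k - 1 / 2) := by
  cases k with
  | zero =>
    have h : ∀ j : ℕ, rayIntegral (2 * Real.pi * (j + 1)) 0 +
        starRingEnd ℂ (rayIntegral (2 * Real.pi * (j + 1)) 0) = 0 := fun j =>
      rayIntegral_zero_add_conj (by have := Real.pi_pos; positivity)
    simp only [h, Nat.cast_zero, regZeta_zero, sub_self]
    exact hasSum_zero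
  | succ k => simpa using hasSum_rayIntegral_succ k

/-! ### The Newton coefficients as a series of integrals. -/

/-- `∫ e ^ (-i a u) (u / (1 + u)) ^ n du` along the ray of argument `-π / 4`. -/
noncomputable def noerlundIntegral (a : ℝ) (n : ℕ) : ℂ :=
  τ * ∫ s in Set.Ioi (0 : ℝ), Complex.exp (-(a * σ * s)) * (τ * s / (1 + τ * s)) ^ n

/-- The binomial theorem under the integral sign, from u/(1+u) = 1 - 1/(1+u). -/
lemma sum_choose_mul_rayIntegral {a : ℝ} (ha : 0 < a) (n : ℕ) :
    ∑ k ∈ Finset.range (n + 1), (n.choose k : ℂ) * (-1) ^ k * rayIntegral a k =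
      noerlundIntegral a n := by
  simp only [rayIntegral, noerlundIntegral, mul_left_comm _ τ]
  rw [← Finset.mul_sum]
  congr 1
  simp only [← MeasureTheory.integral_const_mul]
  rw [← MeasureTheory.integral_finsetSum _
    fun k _ => (integrableOn_rayIntegral ha k).const_mul _]
  refine MeasureTheory.setIntegral_congr_fun measurableSet_Ioi fun s hs => ?_
  have hne := one_add_eighthRootConj_mul_ne_zero hs
  have h : τ * s / (1 + τ * s) = -(1 / (1 + τ * s)) + 1 := by
    field_simp
    ring
  rw [h, add_pow, Finset.mul_sum]
  refine Finset.sum_congr rfl fun k _ => ?_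
  rw [neg_pow, one_pow]
  ring

theorem hasSum_noerlundIntegral {n : ℕ} (hn : 1 ≤ n) :
    HasSum (fun j : ℕ => noerlundIntegral (2 * Real.pi * (j + 1)) n +
      starRingEnd ℂ (noerlundIntegral (2 * Real.pi * (j + 1)) n)) (b n) := by
  have h := hasSum_sum (s := Finset.range (n + 1)) fun k _ =>
    (hasSum_rayIntegral k).mul_left ((n.choose k : ℂ) * (-1) ^ k)
  -- This removes the constant 1/2 from φ(k) - 1/2; it fails for n = 0.
  have h0 : ∑ k ∈ Finset.range (n + 1), (n.choose k : ℂ) * (-1) ^ k = 0 := by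
    have := add_pow (-1 : ℂ) 1 n
    rw [neg_add_cancel, zero_pow (by omega)] at this
    rw [this]
    exact Finset.sum_congr rfl fun _ _ => by ring
  convert! h using 1
  · funext j
    have ha : 0 < 2 * Real.pi * ((j : ℝ) + 1) := by
      have := Real.pi_pos
      positivity
    rw [← sum_choose_mul_rayIntegral ha, map_sum, ← Finset.sum_add_distrib]
    refine Finset.sum_congr rfl fun k _ => ?_
    simp only [map_mul, map_pow, map_neg, map_one, Complex.conj_natCast]
    ring
  · simp only [mul_sub, Finset.sum_sub_distrib, ← Finset.sum_mul, h0]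
    rw [b_eq_newtonCoeff hn, newtonCoeff]
    simp

/-! ### Bounds for the Möbius factor, and the terms of higher frequency. -/

/-- The Möbius factor `u / (1 + u)` along the ray of argument `-π / 4`. -/
noncomputable def rayFactor (s : ℝ) : ℂ := τ * s / (1 + τ * s)

lemma norm_rayFactor_le_self {s : ℝ} (hs : 0 < s) : ‖rayFactor s‖ ≤ s := by
  rw [rayFactor, norm_div, norm_mul, norm_eighthRootConj, one_mul, Complex.norm_real,
    Real.norm_of_nonneg hs.le]
  exact div_le_self hs.le (one_le_norm_one_add_eighthRootConj_mul hs)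

lemma sq_norm_rayFactor {s : ℝ} (hs : 0 < s) :
    ‖rayFactor s‖ ^ 2 = s ^ 2 / (1 + √2 * s + s ^ 2) := by
  have h2 := sqrt_two_mul_self
  rw [rayFactor, norm_div, norm_mul, norm_eighthRootConj, one_mul, Complex.norm_real,
    Real.norm_of_nonneg hs.le, div_pow, ← Complex.normSq_eq_norm_sq, Complex.normSq_apply]
  congr 1
  simp
  linear_combination (s ^ 2 / 2) * h2

/-- The squared norm is s²/(1+√2s+s²). For s ≤ 1 it is at most 1/3 ≤ e^{-1}; for s ≥ 1 use e^{1/s} ≤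
1 + 1/s + 1/s² and √2 ≥ 1. -/
lemma norm_rayFactor_le_exp {s : ℝ} (hs : 0 < s) :
    ‖rayFactor s‖ ≤ Real.exp (-(1 / (2 * max s 1))) := by
  have h2 := sqrt_two_mul_self
  have h1 : 1 ≤ √2 := Real.one_le_sqrt.2 (by norm_num)
  have hden : 0 < 1 + √2 * s + s ^ 2 := by positivity
  refine le_of_sq_le_sq ?_ (Real.exp_pos _).le
  rw [sq_norm_rayFactor hs, ← Real.exp_nat_mul]
  rcases le_total s 1 with h | h
  · rw [max_eq_right h, div_le_iff₀ hden]
    have he := Real.exp_one_lt_d9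
    have h3 : (1 : ℝ) / 3 ≤ Real.exp ((2 : ℕ) * -(1 / (2 * 1))) := by
      rw [show ((2 : ℕ) : ℝ) * -(1 / (2 * 1)) = -1 by norm_num, Real.exp_neg, one_div]
      exact inv_anti₀ (Real.exp_pos _) (by linarith)
    have h4 : s ^ 2 ≤ 1 / 3 * (1 + √2 * s + s ^ 2) := by nlinarith
    exact h4.trans (mul_le_mul_of_nonneg_right h3 hden.le)
  · rw [max_eq_left h, show ((2 : ℕ) : ℝ) * -(1 / (2 * s)) = -(1 / s) by push_cast; field_simp,
      Real.exp_neg, ← one_div, div_le_div_iff₀ hden (Real.exp_pos _), one_mul]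
    have hq : |1 / s| ≤ 1 := by
      rw [abs_of_pos (by positivity)]
      exact (div_le_one hs).2 h
    have h3 := (abs_le.1 (Real.abs_exp_sub_one_sub_id_le hq)).2
    have h4 : s ^ 2 * Real.exp (1 / s) ≤ s ^ 2 * ((1 / s) ^ 2 + 1 + 1 / s) := by
      gcongr
      linarith
    have h5 : s ^ 2 * ((1 / s) ^ 2 + 1 + 1 / s) = 1 + s + s ^ 2 := by
      field_simp
      ring
    nlinarith

lemma norm_rayFactor_pow_le {s : ℝ} (hs : 0 < s) (n : ℕ) :
    ‖rayFactor s‖ ^ n ≤ Real.exp (-(n / (2 * max s 1))) := by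
  refine (pow_le_pow_left₀ (norm_nonneg _) (norm_rayFactor_le_exp hs) n).trans_eq ?_
  rw [← Real.exp_nat_mul]
  congr 1
  ring

lemma continuousOn_rayFactor : ContinuousOn rayFactor (Set.Ioi 0) :=
  ContinuousOn.div (by fun_prop) (by fun_prop)
    fun x hx => one_add_eighthRootConj_mul_ne_zero hx

lemma norm_rayFactor_le_one {s : ℝ} (hs : 0 < s) : ‖rayFactor s‖ ≤ 1 :=
  (norm_rayFactor_le_exp hs).trans (Real.exp_le_one_iff.2 (by
    have : 0 < max s 1 := lt_max_of_lt_left hs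
    rw [neg_nonpos]
    positivity))

lemma noerlundIntegral_eq (a : ℝ) (n : ℕ) : noerlundIntegral a n =
    τ * ∫ s in Set.Ioi (0 : ℝ), Complex.exp (-(a * σ * s)) * rayFactor s ^ n := rfl

lemma integrableOn_noerlundIntegral {a : ℝ} (ha : 0 < a) (n : ℕ) :
    MeasureTheory.IntegrableOn
      (fun s : ℝ => Complex.exp (-(a * σ * s)) * rayFactor s ^ n) (Set.Ioi 0) := by
  refine integrableOn_cexp_eighthRoot_mul ha (continuousOn_rayFactor.pow n) fun s hs => ?_
  rw [norm_pow]
  exact pow_le_one₀ (norm_nonneg _) (norm_rayFactor_le_one hs)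

/-- For s ≥ 1 this is the arithmetic-geometric inequality m/(2s) + 8s ≥ 4√m. For s ≤ 1 the term m/2
alone suffices once √m ≥ 8, whence the threshold 64. -/
lemma norm_rayFactor_pow_mul_exp_le {m : ℕ} (hm : 64 ≤ m) {s : ℝ} (hs : 0 < s) :
    ‖rayFactor s‖ ^ m * Real.exp (-(8 * s)) ≤ Real.exp (-(4 * √m)) := by
  refine (mul_le_mul_of_nonneg_right (norm_rayFactor_pow_le hs m) (Real.exp_pos _).le).trans ?_
  rw [← Real.exp_add]
  refine Real.exp_le_exp.2 ?_
  have hm' : (64 : ℝ) ≤ m := by exact_mod_cast hm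
  have hsq : √(m : ℝ) ^ 2 = m := Real.sq_sqrt (by positivity)
  have hsq8 : 8 ≤ √(m : ℝ) := Real.le_sqrt_of_sq_le (by linarith)
  set r := √(m : ℝ)
  rw [← hsq]
  rcases le_total s 1 with h | h
  · rw [max_eq_right h]
    nlinarith
  · rw [max_eq_left h]
    have : r ^ 2 / (2 * s) + 8 * s - 4 * r = (r - 4 * s) ^ 2 / (2 * s) := by
      field_simp
      ring
    have : 0 ≤ (r - 4 * s) ^ 2 / (2 * s) := by positivity
    linarith

/-- Of the decay rate √2π(j+2), a part 8 goes into the factor e^{-4√m} and a part c stays. One of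
the m+1 Möbius factors is bounded by s, so that ∫ s e^{-cs} ds = 1/c² is summable in j. -/
lemma norm_noerlundIntegral_le {m : ℕ} (hm : 64 ≤ m) (j : ℕ) :
    ‖noerlundIntegral (2 * Real.pi * ((j + 1 : ℕ) + 1)) (m + 1)‖ ≤
      Real.exp (-(4 * √m)) * (25 / 4 * (1 / ((j : ℝ) + 2) ^ 2)) := by
  have hpi := Real.pi_gt_d6
  have h2 := sqrt_two_mul_self
  have hs2 : (1.414 : ℝ) ≤ √2 := Real.le_sqrt_of_sq_le (by norm_num)
  have hj : (0 : ℝ) ≤ j := j.cast_nonneg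
  have ha : 0 < 2 * Real.pi * (((j + 1 : ℕ) : ℝ) + 1) := by positivity
  -- Since √2π ≥ 4.4, the rate minus c is at least 4(j+2) ≥ 8.
  set c : ℝ := 2 / 5 * (j + 2) with hc
  have hc0 : 0 < c := by positivity
  have hac : 8 + c ≤ 2 * Real.pi * (((j + 1 : ℕ) : ℝ) + 1) * (√2 / 2) := by
    have h3 : (4.4 : ℝ) ≤ Real.pi * √2 := by nlinarith
    push_cast
    rw [hc]
    nlinarith
  rw [noerlundIntegral_eq, norm_mul, norm_eighthRootConj, one_mul]
  have hb := (integrableOn_pow_mul_exp_neg_mul 1 hc0).const_mul (Real.exp (-(4 * √m)))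
  refine (MeasureTheory.norm_integral_le_of_norm_le hb ?_).trans_eq ?_
  · refine (MeasureTheory.ae_restrict_iff' measurableSet_Ioi).2
      (MeasureTheory.ae_of_all _ fun s hs => ?_)
    have hs : 0 < s := hs
    rw [norm_mul, norm_pow, norm_cexp_neg_eighthRoot, pow_succ, pow_one]
    have h4 : Real.exp (-(2 * Real.pi * (((j + 1 : ℕ) : ℝ) + 1) * (√2 / 2) * s)) ≤
        Real.exp (-(8 * s)) * Real.exp (-(c * s)) := by
      rw [← Real.exp_add]
      refine Real.exp_le_exp.2 ?_
      nlinarith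
    calc _ ≤ (Real.exp (-(8 * s)) * Real.exp (-(c * s))) * (‖rayFactor s‖ ^ m * s) := by
          gcongr
          exact norm_rayFactor_le_self hs
      _ = (‖rayFactor s‖ ^ m * Real.exp (-(8 * s))) * (s * Real.exp (-(c * s))) := by ring
      _ ≤ _ := by
          gcongr
          exact norm_rayFactor_pow_mul_exp_le hm hs
  · rw [MeasureTheory.integral_const_mul]
    have h := Real.integral_rpow_mul_exp_neg_mul_Ioi (a := 2) two_pos hc0
    have h5 : Real.Gamma 2 = 1 := by simp
    norm_num [h5] at h
    rw [hc] at *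
    simp only [pow_one]
    rw [h]
    field_simp
    norm_num

lemma exp_neg_mul_sqrt_isBigO {c : ℝ} (hc : 2 * √Real.pi < c) :
    (fun n : ℕ => Real.exp (-(c * √n))) =O[atTop]
      (fun n : ℕ => (n : ℝ) ^ (-(1 / 4) : ℝ) * Real.exp (-2 * √(Real.pi * n))) := by
  have h := (tendsto_rpow_mul_exp_neg_mul_atTop_nhds_zero (1 / 2) (c - 2 * √Real.pi)
    (by linarith)).comp (Real.tendsto_sqrt_atTop.comp tendsto_natCast_atTop_atTop)
  refine IsBigO.of_bound 1 ?_
  filter_upwards [h.eventually (ge_mem_nhds one_pos), eventually_gt_atTop 0] with n hn hn0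
  have hn0' : (0 : ℝ) < n := by exact_mod_cast hn0
  simp only [Function.comp_apply] at hn
  have h1 : √(n : ℝ) ^ (1 / 2 : ℝ) = (n : ℝ) ^ (1 / 4 : ℝ) := by
    rw [Real.sqrt_eq_rpow, ← Real.rpow_mul hn0'.le]
    norm_num
  rw [h1] at hn
  have h2 : (0 : ℝ) < (n : ℝ) ^ (1 / 4 : ℝ) := by positivity
  rw [Real.norm_of_nonneg (Real.exp_pos _).le, Real.norm_of_nonneg (by positivity), one_mul,
    Real.rpow_neg hn0'.le, Real.sqrt_mul Real.pi_pos.le]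
  have h3 : Real.exp (-(c * √n)) = Real.exp (-(c - 2 * √Real.pi) * √n) *
      Real.exp (-2 * (√Real.pi * √n)) := by
    rw [← Real.exp_add]
    congr 1
    ring
  rw [h3]
  refine mul_le_mul_of_nonneg_right ?_ (Real.exp_pos _).le
  rw [inv_eq_one_div, le_div_iff₀ h2, mul_comm]
  exact hn

lemma sqrt_pi_lt : √Real.pi < 1.78 := by
  rw [Real.sqrt_lt' (by norm_num)]
  have := Real.pi_lt_d2
  linarith

theorem b_sub_noerlundIntegral_isBigO :
    (fun n : ℕ => b n - (noerlundIntegral (2 * Real.pi) n +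
      starRingEnd ℂ (noerlundIntegral (2 * Real.pi) n))) =O[atTop]
      (fun n : ℕ => (n : ℝ) ^ (-(1 / 4) : ℝ) * Real.exp (-2 * √(Real.pi * n))) := by
  have hsum : Summable fun j : ℕ => 25 / 4 * (1 / ((j : ℝ) + 2) ^ 2) := by
    have := (summable_nat_add_iff 2).2 (Real.summable_one_div_nat_pow.2 one_lt_two)
    refine Summable.mul_left _ ?_
    simpa using this
  -- 3.6 lies strictly between 2√π ≈ 3.545 and the rate 4 of the tail; the gap up to 4 absorbs the
  -- shift from m to m+1.
  refine IsBigO.trans ?_ (exp_neg_mul_sqrt_isBigO (c := 3.6) (by linarith [sqrt_pi_lt]))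
  refine IsBigO.of_bound (2 * ∑' j : ℕ, 25 / 4 * (1 / ((j : ℝ) + 2) ^ 2)) ?_
  filter_upwards [eventually_ge_atTop 65] with n hn
  obtain ⟨m, rfl⟩ : ∃ m, n = m + 1 := ⟨n - 1, by omega⟩
  have hm : 64 ≤ m := by omega
  have h := (hasSum_nat_add_iff' 1).2 (hasSum_noerlundIntegral (n := m + 1) (by omega))
  simp only [Finset.range_one, Finset.sum_singleton, Nat.cast_zero, zero_add, mul_one] at h
  rw [← h.tsum_eq]
  have hle : Real.exp (-(4 * √m)) ≤ Real.exp (-(3.6 * √(m + 1 : ℕ))) := by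
    refine Real.exp_le_exp.2 ?_
    have hm' : (64 : ℝ) ≤ m := by exact_mod_cast hm
    have : √((m + 1 : ℕ) : ℝ) ≤ 10 / 9 * √m := by
      rw [Real.sqrt_le_left (by positivity), mul_pow, Real.sq_sqrt (by positivity)]
      push_cast
      linarith
    linarith
  refine (tsum_of_norm_bounded (g := fun j : ℕ => Real.exp (-(4 * √m)) *
    (2 * (25 / 4 * (1 / ((j : ℝ) + 2) ^ 2)))) ((hsum.mul_left 2).mul_left _).hasSum
      fun j => ?_).trans ?_
  · refine (norm_add_le _ _).trans ?_
    rw [RCLike.norm_conj]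
    have := norm_noerlundIntegral_le hm j
    linarith
  · rw [tsum_mul_left, tsum_mul_left, Real.norm_of_nonneg (Real.exp_pos _).le, mul_comm]
    refine mul_le_mul_of_nonneg_left hle ?_
    have : 0 ≤ ∑' j : ℕ, 25 / 4 * (1 / ((j : ℝ) + 2) ^ 2) := tsum_nonneg fun j => by positivity
    positivity

/-! ### Exponential approximation of the Möbius factor. -/

/-- This is log(1+w) = w - w²/2 + O(w³) in exponentiated form, without logarithms: both sides agree
with 1 - w + w² up to cubic terms. -/
lemma norm_inv_one_add_sub_cexp_le {w : ℂ} (hw : ‖w‖ ≤ 1) (hre : 0 ≤ w.re) :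
    ‖(1 + w)⁻¹ - Complex.exp (-w + w ^ 2 / 2)‖ ≤ 40 * ‖w‖ ^ 3 := by
  have hw0 := norm_nonneg w
  have h1 : 1 ≤ ‖1 + w‖ := by
    refine le_trans ?_ (Complex.re_le_norm _)
    simpa using hre
  have hne : 1 + w ≠ 0 := by
    rw [← norm_pos_iff]
    linarith
  set z : ℂ := -w + w ^ 2 / 2 with hz
  have hzn : ‖z‖ ≤ 3 / 2 * ‖w‖ := by
    refine (norm_add_le _ _).trans ?_
    rw [norm_neg, norm_div, norm_pow, Complex.norm_ofNat]
    nlinarith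
  have hR := Complex.norm_exp_sub_sum_le_norm_mul_exp z 3
  simp only [Finset.sum_range_succ, Finset.sum_range_zero, pow_zero, pow_one, zero_add] at hR
  norm_num at hR
  have hexp : Real.exp ‖z‖ ≤ 9 := by
    have h2 : Real.exp ‖z‖ ≤ Real.exp 2 := Real.exp_le_exp.2 (by linarith)
    have h3 : Real.exp 2 = Real.exp 1 ^ 2 := by rw [← Real.exp_nat_mul]; norm_num
    have h4 := Real.exp_one_lt_d9
    have h5 := Real.exp_pos 1
    nlinarith
  have hR2 : ‖z‖ ^ 3 * Real.exp ‖z‖ ≤ (3 / 2 * ‖w‖) ^ 3 * 9 := by gcongr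
  have hid : (1 + w)⁻¹ - Complex.exp z = -(w ^ 3 * (1 + w)⁻¹) + (w ^ 3 / 2 - w ^ 3 * w / 8) -
      (Complex.exp z - (1 + z + z ^ 2 / 2)) := by
    rw [hz]
    field_simp
    ring
  rw [hid]
  have h6 : ‖w ^ 3 * (1 + w)⁻¹‖ ≤ ‖w‖ ^ 3 := by
    rw [norm_mul, norm_pow, norm_inv]
    exact mul_le_of_le_one_right (by positivity) (inv_le_one_of_one_le₀ h1)
  have h7 : ‖w ^ 3 / 2 - w ^ 3 * w / 8‖ ≤ ‖w‖ ^ 3 := by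
    refine (norm_sub_le _ _).trans ?_
    rw [norm_div, norm_div, norm_mul, norm_pow, Complex.norm_ofNat, Complex.norm_ofNat]
    have : 0 ≤ ‖w‖ ^ 3 := by positivity
    nlinarith
  refine (norm_sub_le _ _).trans ?_
  have h8 := norm_add_le (-(w ^ 3 * (1 + w)⁻¹)) (w ^ 3 / 2 - w ^ 3 * w / 8)
  rw [norm_neg] at h8
  have : 0 ≤ ‖w‖ ^ 3 := by positivity
  nlinarith

lemma norm_pow_succ_sub_pow_succ_le {a b : ℂ} {M : ℝ} (ha : ‖a‖ ≤ M) (hb : ‖b‖ ≤ M) (n : ℕ) :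
    ‖a ^ (n + 1) - b ^ (n + 1)‖ ≤ (n + 1) * ‖a - b‖ * M ^ n := by
  have hM : 0 ≤ M := (norm_nonneg a).trans ha
  induction n with
  | zero => simp
  | succ n ih =>
    have h : a ^ (n + 1 + 1) - b ^ (n + 1 + 1) =
        a * (a ^ (n + 1) - b ^ (n + 1)) + (a - b) * b ^ (n + 1) := by ring
    rw [h]
    refine (norm_add_le _ _).trans ?_
    rw [norm_mul, norm_mul, norm_pow]
    calc _ ≤ M * ((n + 1) * ‖a - b‖ * M ^ n) + ‖a - b‖ * M ^ (n + 1) := by gcongr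
      _ = _ := by push_cast; ring

/-- The approximation to `rayFactor s ^ n` for `s` of order `√n`. -/
noncomputable def saddleFactor (n : ℕ) (s : ℝ) : ℂ :=
  Complex.exp (n * (-(σ / s) + (σ / s) ^ 2 / 2))

/-- On this ray (σ/s)² = i/s² is purely imaginary, so the quadratic term of the exponent affects
only the phase. -/
lemma norm_saddleFactor (n : ℕ) (s : ℝ) :
    ‖saddleFactor n s‖ = Real.exp (-(n * (√2 / 2) / s)) := by
  rw [saddleFactor, Complex.norm_exp, div_pow, eighthRoot_sq,
    show Complex.I / (s : ℂ) ^ 2 / 2 = ((1 / s ^ 2 / 2 : ℝ) : ℂ) * Complex.I by push_cast; ring]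
  congr 1
  rw [← Complex.ofReal_natCast, Complex.re_ofReal_mul]
  simp only [Complex.add_re, Complex.neg_re, Complex.div_ofReal_re, eighthRoot_re,
    Complex.re_ofReal_mul, Complex.I_re, mul_zero, add_zero]
  ring

lemma norm_rayFactor_pow_sub_saddleFactor_le {s : ℝ} (hs : 1 ≤ s) {n : ℕ} (hn : 1 ≤ n) :
    ‖rayFactor s ^ n - saddleFactor n s‖ ≤
      120 * (n / s ^ 3) * Real.exp (120 * (n / s ^ 3)) * Real.exp (-(n * (√2 / 2) / s)) := by
  obtain ⟨m, rfl⟩ : ∃ m, n = m + 1 := ⟨n - 1, by omega⟩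
  have hs0 : 0 < s := by linarith
  have hs0' : (s : ℂ) ≠ 0 := by exact_mod_cast hs0.ne'
  have h2 : √2 / 2 ≤ 1 := by
    have : √2 ≤ 2 := by rw [Real.sqrt_le_left] <;> norm_num
    linarith
  set w : ℂ := σ / s with hw
  have hwn : ‖w‖ = 1 / s := by
    rw [hw, norm_div, norm_eighthRoot, Complex.norm_real, Real.norm_of_nonneg hs0.le]
  have hq1 : 1 / s ≤ 1 := (div_le_one hs0).2 hs
  have hq0 : 0 < 1 / s := by positivity
  have hray : rayFactor s = (1 + w)⁻¹ := by
    have h3 := one_add_eighthRootConj_mul_ne_zero hs0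
    have h4 : τ ≠ 0 := right_ne_zero_of_mul_eq_one eighthRoot_mul_conj
    have h5 : 1 + w = (1 + τ * s) / (τ * s) := by
      rw [hw]
      field_simp
      linear_combination eighthRoot_mul_conj
    rw [h5, inv_div, rayFactor]
  have hT := norm_inv_one_add_sub_cexp_le (w := w) (hwn ▸ hq1) (by
    rw [hw, Complex.div_ofReal_re, eighthRoot_re]; positivity)
  set e : ℂ := Complex.exp (-w + w ^ 2 / 2) with he
  have hen : ‖e‖ = Real.exp (-((√2 / 2) / s)) := by
    have := norm_saddleFactor 1 s
    simpa [saddleFactor, ← hw, ← he] using this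
  have hpow : saddleFactor (m + 1) s = e ^ (m + 1) := by
    rw [saddleFactor, he, ← Complex.exp_nat_mul]
  rw [hwn] at hT
  have hexp1 : Real.exp ((√2 / 2) / s) ≤ 3 := by
    have h3 : (√2 / 2) / s ≤ 1 := by
      rw [div_le_one hs0]; linarith
    have := Real.exp_one_lt_d9
    linarith [Real.exp_le_exp.2 h3]
  -- A common bound for the two bases. The additive error 40/s³ becomes the multiplicative 1 +
  -- 120/s³ because the smaller base is at least 1/3.
  set M : ℝ := Real.exp (-((√2 / 2) / s) + 120 * (1 / s) ^ 3) with hM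
  have hbM : ‖e‖ ≤ M := by
    rw [hen, hM]
    refine Real.exp_le_exp.2 ?_
    have : 0 < 120 * (1 / s) ^ 3 := by positivity
    linarith
  have haM : ‖(1 + w)⁻¹‖ ≤ M := by
    have h3 : ‖(1 + w)⁻¹‖ ≤ ‖e‖ + 40 * (1 / s) ^ 3 := by
      have := norm_add_le e ((1 + w)⁻¹ - e)
      rw [add_sub_cancel] at this
      linarith
    have h4 : Real.exp (-((√2 / 2) / s)) * Real.exp ((√2 / 2) / s) = 1 := by
      rw [← Real.exp_add, neg_add_cancel, Real.exp_zero]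
    have h5 : 0 < Real.exp (-((√2 / 2) / s)) := Real.exp_pos _
    have h6 : 1 ≤ Real.exp (-((√2 / 2) / s)) * 3 := by
      rw [← h4]; gcongr
    have h7 := Real.add_one_le_exp (120 * (1 / s) ^ 3)
    have h8 : 0 < (1 / s) ^ 3 := by positivity
    rw [hM, Real.exp_add]
    calc _ ≤ Real.exp (-((√2 / 2) / s)) * (120 * (1 / s) ^ 3 + 1) := by
          rw [hen] at h3
          nlinarith
      _ ≤ _ := by gcongr
  rw [hray, hpow]
  refine (norm_pow_succ_sub_pow_succ_le haM hbM m).trans ?_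
  -- Passing from exponent m to m+1 costs e^{(√2/2)/s} ≤ 3.
  have hMm : M ^ m ≤ 3 * Real.exp (120 * ((m + 1 : ℕ) / s ^ 3)) *
      Real.exp (-((m + 1 : ℕ) * (√2 / 2) / s)) := by
    have h3 : M ^ m ≤ Real.exp ((√2 / 2) / s) * (Real.exp (120 * ((m + 1 : ℕ) / s ^ 3)) *
        Real.exp (-((m + 1 : ℕ) * (√2 / 2) / s))) := by
      rw [hM, ← Real.exp_nat_mul, ← Real.exp_add, ← Real.exp_add]
      refine Real.exp_le_exp.2 ?_
      have h9 : 0 < 120 * (1 / s) ^ 3 := by positivity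
      have h10 : (√2 / 2) / s + (120 * ((m + 1 : ℕ) / s ^ 3) + -((m + 1 : ℕ) * (√2 / 2) / s)) =
        m * (-((√2 / 2) / s) + 120 * (1 / s) ^ 3) + 120 * (1 / s) ^ 3 := by
        push_cast
        field_simp
        ring
      rw [h10]
      linarith
    refine h3.trans ?_
    rw [mul_assoc]
    gcongr
  calc _ ≤ ((m : ℝ) + 1) * (40 * (1 / s) ^ 3) * (3 * Real.exp (120 * ((m + 1 : ℕ) / s ^ 3)) *
      Real.exp (-((m + 1 : ℕ) * (√2 / 2) / s))) := by gcongr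
    _ = _ := by
      push_cast
      field_simp
      ring

lemma exists_norm_rayFactor_pow_sub_saddleFactor_le : ∃ C : ℝ, 0 ≤ C ∧ ∀ n : ℕ, 144 ≤ n →
    ∀ s : ℝ, 0 < s → ‖rayFactor s ^ n - saddleFactor n s‖ ≤
      C / √n * Real.exp (-(n * (√2 / 2) / s)) + 2 * Real.exp (-(6 * √n)) := by
  refine ⟨120 * 1728 * Real.exp (120 * 1728), by positivity, fun n hn s hs => ?_⟩
  have hn' : (144 : ℝ) ≤ n := by exact_mod_cast hn
  have hr : 12 ≤ √(n : ℝ) := Real.le_sqrt_of_sq_le (by linarith)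
  have hrr : √(n : ℝ) ^ 2 = n := Real.sq_sqrt (by positivity)
  set r := √(n : ℝ)
  have hr0 : 0 < r := by linarith
  -- Above √n/12 one has s ≥ 1 and n/s³ ≤ 12³/√n. Below it, both factors are at most e^{-6√n}, and 6
  -- exceeds 2√π.
  rcases le_total (r / 12) s with h | h
  · have hs1 : 1 ≤ s := by linarith
    have h1 : (n : ℝ) / s ^ 3 ≤ 1728 / r := by
      rw [div_le_div_iff₀ (by positivity) hr0, ← hrr]
      have : (r / 12) ^ 3 ≤ s ^ 3 := by gcongr
      nlinarith
    have h2 : 1728 / r ≤ 1728 := div_le_self (by norm_num) (by linarith)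
    refine (norm_rayFactor_pow_sub_saddleFactor_le hs1 (by omega)).trans ?_
    have h3 : 120 * ((n : ℝ) / s ^ 3) * Real.exp (120 * (n / s ^ 3)) ≤
        120 * (1728 / r) * Real.exp (120 * 1728) := by
      have := h1.trans h2
      gcongr
    refine le_add_of_le_of_nonneg ?_ (by positivity)
    refine mul_le_mul_of_nonneg_right (h3.trans_eq ?_) (Real.exp_pos _).le
    ring
  · refine le_add_of_nonneg_of_le (by positivity) ?_
    have h1 : Real.exp (-(n / (2 * max s 1))) ≤ Real.exp (-(6 * r)) := by
      refine Real.exp_le_exp.2 (neg_le_neg ?_)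
      have hm : max s 1 ≤ r / 12 := max_le h (by linarith)
      have hm0 : 0 < max s 1 := lt_max_of_lt_left hs
      rw [le_div_iff₀ (by positivity), ← hrr]
      nlinarith
    have h2 : Real.exp (-(n * (√2 / 2) / s)) ≤ Real.exp (-(6 * r)) := by
      refine Real.exp_le_exp.2 (neg_le_neg ?_)
      have h3 : 1 ≤ √2 := Real.one_le_sqrt.2 (by norm_num)
      rw [le_div_iff₀ hs, ← hrr]
      nlinarith
    refine (norm_sub_le _ _).trans ?_
    rw [norm_pow, norm_saddleFactor]
    have := norm_rayFactor_pow_le hs n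
    linarith

/-! ### The saddle-point integral in the variable x. -/

lemma one_add_sq_div_two_le_cosh (x : ℝ) : 1 + x ^ 2 / 2 ≤ Real.cosh x := by
  have h : ∀ y : ℝ, 0 ≤ y → 1 + y ^ 2 / 2 ≤ Real.cosh y := by
    intro y hy
    have h1 : Real.cosh y = 1 + 2 * Real.sinh (y / 2) ^ 2 := by
      have := Real.cosh_two_mul (y / 2)
      rw [mul_div_cancel₀ _ two_ne_zero] at this
      rw [this, Real.cosh_sq]
      ring
    have h2 : y / 2 ≤ Real.sinh (y / 2) := Real.self_le_sinh_iff.2 (by linarith)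
    rw [h1]
    nlinarith
  rw [← Real.cosh_abs, ← sq_abs]
  exact h _ (abs_nonneg x)

lemma abs_exp_sub_sum_le (x : ℝ) (n : ℕ) :
    |Real.exp x - ∑ m ∈ Finset.range n, x ^ m / m.factorial| ≤ |x| ^ n * Real.exp |x| := by
  have h := Complex.norm_exp_sub_sum_le_norm_mul_exp x n
  rw [Complex.norm_real, Real.norm_eq_abs] at h
  rw [← Real.norm_eq_abs, ← Complex.norm_real]
  push_cast
  exact h

lemma cosh_sub_le (x : ℝ) : Real.cosh x - 1 - x ^ 2 / 2 ≤ x ^ 4 * Real.exp |x| := by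
  have h1 := (abs_le.1 (abs_exp_sub_sum_le x 4)).2
  have h2 := (abs_le.1 (abs_exp_sub_sum_le (-x) 4)).2
  rw [abs_neg, Even.pow_abs (by decide)] at h2
  rw [Even.pow_abs (by decide)] at h1
  simp only [Finset.sum_range_succ, Finset.sum_range_zero, Nat.factorial] at h1 h2
  norm_num at h1 h2
  rw [Real.cosh_eq]
  nlinarith

lemma norm_cexp_neg_sub_one_le {z : ℂ} (hz : 0 ≤ z.re) : ‖Complex.exp (-z) - 1‖ ≤ 2 * ‖z‖ := by
  rcases le_total ‖z‖ 1 with h | h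
  · simpa using Complex.norm_exp_sub_one_le (x := -z) (by simpa using h)
  · refine (norm_sub_le _ _).trans ?_
    rw [Complex.norm_exp, norm_one]
    have : Real.exp (-z).re ≤ 1 := Real.exp_le_one_iff.2 (by simpa using hz)
    linarith

lemma norm_cexp_I_mul_sub_one_sub_le (θ : ℝ) :
    ‖Complex.exp (Complex.I * θ) - 1 - Complex.I * θ‖ ≤ 2 * θ ^ 2 := by
  have hn : ‖Complex.I * (θ : ℂ)‖ = |θ| := by simp
  rcases le_total |θ| 1 with h | h
  · have := Complex.norm_exp_sub_one_sub_id_le (x := Complex.I * θ) (by rwa [hn])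
    rw [hn, sq_abs] at this
    nlinarith [sq_nonneg θ]
  · refine (norm_sub_le _ _).trans ?_
    have h1 : ‖Complex.exp (Complex.I * θ) - 1‖ ≤ ‖θ‖ := Real.norm_exp_I_mul_ofReal_sub_one_le
    rw [hn]
    rw [Real.norm_eq_abs] at h1
    rw [← sq_abs]
    nlinarith

/-- The amplitude of the saddle-point integral. -/
noncomputable def amplitude (x : ℝ) : ℂ :=
  Complex.exp (x + Complex.I * (Real.pi * Real.exp (-(2 * x)) : ℝ))

lemma norm_amplitude (x : ℝ) : ‖amplitude x‖ = Real.exp x := by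
  rw [amplitude, Complex.norm_exp]
  congr 1
  simp [-Complex.ofReal_mul, -Complex.ofReal_exp]

lemma continuous_amplitude : Continuous amplitude := by
  unfold amplitude
  fun_prop

/-- First-order expansion at 0, where the amplitude is e^{iπ} = -1. With θ = π(e^{-2x} - 1) ≈ -2πx,
it equals -e^x e^{iθ} ≈ -(1 + x)(1 - 2πix). -/
lemma norm_amplitude_sub_le (x : ℝ) :
    ‖amplitude x + 1 + (1 - 2 * Real.pi * Complex.I) * x‖ ≤
      (1 + 4 * Real.pi + 2 * Real.pi + 8 * Real.pi ^ 2) * (x ^ 2 * Real.exp (5 * |x|)) := by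
  have hpi := Real.pi_pos
  set θ : ℝ := Real.pi * (Real.exp (-(2 * x)) - 1) with hθ
  have hamp : amplitude x = -(Real.exp x * Complex.exp (Complex.I * θ)) := by
    rw [amplitude, hθ, show Real.pi * Real.exp (-(2 * x)) =
      Real.pi + Real.pi * (Real.exp (-(2 * x)) - 1) by ring, Complex.ofReal_add, mul_add,
      Complex.exp_add, Complex.exp_add, mul_comm Complex.I (Real.pi : ℂ), Complex.exp_pi_mul_I,
      Complex.ofReal_exp]
    ring
  have hE : ∀ a b : ℝ, a ≤ b → Real.exp (a * |x|) ≤ Real.exp (b * |x|) := fun a b hab =>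
    Real.exp_le_exp.2 (mul_le_mul_of_nonneg_right hab (abs_nonneg x))
  have he1 : |Real.exp x - 1| ≤ |x| * Real.exp (1 * |x|) := by
    simpa using abs_exp_sub_sum_le x 1
  have he2 : |Real.exp x - (1 + x)| ≤ x ^ 2 * Real.exp (1 * |x|) := by
    simpa [Finset.sum_range_succ] using abs_exp_sub_sum_le x 2
  have habs : |-(2 * x)| = 2 * |x| := by rw [abs_neg, abs_mul, abs_two]
  have hθ1 : |θ| ≤ 2 * Real.pi * (|x| * Real.exp (2 * |x|)) := by
    have h := abs_exp_sub_sum_le (-(2 * x)) 1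
    simp only [Finset.sum_range_one, pow_zero, Nat.factorial_zero, Nat.cast_one, div_one,
      pow_one, habs] at h
    rw [hθ, abs_mul, abs_of_pos hpi]
    nlinarith
  have hθ2 : |θ + 2 * Real.pi * x| ≤ 4 * Real.pi * (x ^ 2 * Real.exp (2 * |x|)) := by
    have h := abs_exp_sub_sum_le (-(2 * x)) 2
    simp only [Finset.sum_range_succ, Finset.sum_range_zero, zero_add, pow_zero,
      Nat.factorial_zero, Nat.cast_one, div_one, pow_one, habs, Nat.factorial_one] at h
    rw [mul_pow, sq_abs] at h
    rw [show θ + 2 * Real.pi * x = Real.pi * (Real.exp (-(2 * x)) - (1 + -(2 * x))) by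
      rw [hθ]; ring, abs_mul, abs_of_pos hpi]
    nlinarith
  have hR1 := norm_cexp_I_mul_sub_one_sub_le θ
  have hid : amplitude x + 1 + (1 - 2 * Real.pi * Complex.I) * x =
      -(((Real.exp x - (1 + x) : ℝ) : ℂ) + Complex.I * ((θ + 2 * Real.pi * x : ℝ) : ℂ) +
        (((Real.exp x - 1) : ℝ) : ℂ) * (Complex.I * (θ : ℂ)) +
        (Real.exp x : ℝ) * (Complex.exp (Complex.I * θ) - 1 - Complex.I * θ)) := by
    rw [hamp]
    push_cast
    ring
  have hx2 : |x| * |x| = x ^ 2 := by rw [← sq, sq_abs]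
  have t1 : |Real.exp x - (1 + x)| ≤ x ^ 2 * Real.exp (5 * |x|) :=
    he2.trans (mul_le_mul_of_nonneg_left (hE _ _ (by norm_num)) (sq_nonneg x))
  have t2 : |θ + 2 * Real.pi * x| ≤ 4 * Real.pi * (x ^ 2 * Real.exp (5 * |x|)) :=
    hθ2.trans (mul_le_mul_of_nonneg_left (mul_le_mul_of_nonneg_left (hE _ _ (by norm_num))
      (sq_nonneg x)) (by positivity))
  have t3 : |Real.exp x - 1| * |θ| ≤ 2 * Real.pi * (x ^ 2 * Real.exp (5 * |x|)) := by
    calc _ ≤ (|x| * Real.exp (1 * |x|)) * (2 * Real.pi * (|x| * Real.exp (2 * |x|))) := by gcongr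
      _ = 2 * Real.pi * (x ^ 2 * Real.exp (3 * |x|)) := by
        rw [← hx2, show 3 * |x| = 1 * |x| + 2 * |x| by ring, Real.exp_add]
        ring
      _ ≤ _ := by
        have := hE 3 5 (by norm_num)
        gcongr
  have t4 : Real.exp x * (2 * θ ^ 2) ≤ 8 * Real.pi ^ 2 * (x ^ 2 * Real.exp (5 * |x|)) := by
    rw [← sq_abs θ]
    calc _ ≤ Real.exp |x| * (2 * (2 * Real.pi * (|x| * Real.exp (2 * |x|))) ^ 2) := by
          have := le_abs_self x
          gcongr
      _ = _ := by
        rw [← hx2, show 5 * |x| = |x| + (2 * |x| + 2 * |x|) by ring, Real.exp_add, Real.exp_add]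
        ring
  rw [hid, norm_neg]
  refine norm_add₄_le.trans ?_
  rw [norm_mul, norm_mul, norm_mul, norm_mul, Complex.norm_I, Complex.norm_real, Complex.norm_real,
    Complex.norm_real, Complex.norm_real, Complex.norm_real, Real.norm_eq_abs, Real.norm_eq_abs,
    Real.norm_eq_abs, Real.norm_eq_abs, Real.norm_eq_abs, Real.abs_exp, one_mul, one_mul]
  have t5 : Real.exp x * ‖Complex.exp (Complex.I * θ) - 1 - Complex.I * θ‖ ≤
      Real.exp x * (2 * θ ^ 2) := by gcongr
  linarith

/-- The weight `x ^ p e ^ {5 |x|} e ^ {-r² x² / 2}`. -/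
noncomputable def gaussianWeight (p : ℕ) (r x : ℝ) : ℝ :=
  x ^ p * (Real.exp (5 * |x|) * Real.exp (-(r ^ 2 * x ^ 2 / 2)))

lemma integrable_pow_mul_exp_neg_sq_div (p : ℕ) :
    MeasureTheory.Integrable fun y : ℝ => y ^ p * Real.exp (-(y ^ 2 / 4)) := by
  have h := integrable_rpow_mul_exp_neg_mul_sq (b := 1 / 4) (by norm_num) (s := p)
    (by have : (0 : ℝ) ≤ p := p.cast_nonneg
        linarith)
  refine h.congr (MeasureTheory.ae_of_all _ fun x => ?_)
  simp only [Real.rpow_natCast]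
  congr 2
  ring

/-- Half of the Gaussian exponent absorbs e^{5|x|}, through 5|x| ≤ 25 + x²/4 and r ≥ 1. The rest
depends on rx only, so the integral scales as r^{-(p+1)}. -/
lemma gaussianWeight_le {p : ℕ} (hp : Even p) {r : ℝ} (hr : 1 ≤ r) (x : ℝ) :
    gaussianWeight p r x ≤
      Real.exp 25 / r ^ p * ((r * x) ^ p * Real.exp (-((r * x) ^ 2 / 4))) := by
  have hr0 : 0 < r := by linarith
  have hxp : 0 ≤ x ^ p := hp.pow_nonneg x
  have h1 : Real.exp (5 * |x|) * Real.exp (-(r ^ 2 * x ^ 2 / 2)) ≤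
      Real.exp 25 * Real.exp (-((r * x) ^ 2 / 4)) := by
    rw [← Real.exp_add, ← Real.exp_add]
    refine Real.exp_le_exp.2 ?_
    have h2 : 5 * |x| ≤ 25 + x ^ 2 / 4 := by
      rw [← sq_abs]
      nlinarith [sq_nonneg (|x| / 2 - 5)]
    have h3 : x ^ 2 ≤ r ^ 2 * x ^ 2 := le_mul_of_one_le_left (sq_nonneg x) (one_le_pow₀ hr)
    rw [mul_pow]
    linarith
  calc _ ≤ x ^ p * (Real.exp 25 * Real.exp (-((r * x) ^ 2 / 4))) := by
        unfold gaussianWeight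
        gcongr
    _ = _ := by
        rw [mul_pow r x p]
        field_simp

lemma continuous_gaussianWeight (p : ℕ) (r : ℝ) : Continuous (gaussianWeight p r) := by
  unfold gaussianWeight
  fun_prop

lemma gaussianWeight_nonneg {p : ℕ} (hp : Even p) (r x : ℝ) : 0 ≤ gaussianWeight p r x :=
  mul_nonneg (hp.pow_nonneg x) (by positivity)

lemma integrable_gaussianWeight_bound (p : ℕ) {r : ℝ} (hr : 1 ≤ r) :
    MeasureTheory.Integrable fun x : ℝ =>
      Real.exp 25 / r ^ p * ((r * x) ^ p * Real.exp (-((r * x) ^ 2 / 4))) :=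
  ((integrable_pow_mul_exp_neg_sq_div p).comp_mul_left' (by linarith : r ≠ 0)).const_mul _

lemma integrable_gaussianWeight {p : ℕ} (hp : Even p) {r : ℝ} (hr : 1 ≤ r) :
    MeasureTheory.Integrable (gaussianWeight p r) := by
  refine (integrable_gaussianWeight_bound p hr).mono'
    (continuous_gaussianWeight p r).aestronglyMeasurable (MeasureTheory.ae_of_all _ fun x => ?_)
  rw [Real.norm_of_nonneg (gaussianWeight_nonneg hp r x)]
  exact gaussianWeight_le hp hr x

lemma exists_integral_gaussianWeight_le {p : ℕ} (hp : Even p) : ∃ C : ℝ, 0 ≤ C ∧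
    ∀ r : ℝ, 1 ≤ r → ∫ x, gaussianWeight p r x ≤ C / r ^ (p + 1) := by
  refine ⟨Real.exp 25 * ∫ y : ℝ, y ^ p * Real.exp (-(y ^ 2 / 4)), ?_, fun r hr => ?_⟩
  · refine mul_nonneg (Real.exp_pos _).le (MeasureTheory.integral_nonneg fun y => ?_)
    exact mul_nonneg (hp.pow_nonneg y) (Real.exp_pos _).le
  · have hr0 : 0 < r := by linarith
    refine (MeasureTheory.integral_mono (integrable_gaussianWeight hp hr)
      (integrable_gaussianWeight_bound p hr) (gaussianWeight_le hp hr)).trans_eq ?_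
    rw [MeasureTheory.integral_const_mul, MeasureTheory.Measure.integral_comp_mul_left
      (fun y : ℝ => y ^ p * Real.exp (-(y ^ 2 / 4))), abs_of_pos (by positivity), smul_eq_mul]
    field_simp
    ring

/-- The integrand of the saddle-point integral with large parameter `r ^ 2`. -/
noncomputable def saddleIntegrand (r x : ℝ) : ℂ :=
  Complex.exp (-(r ^ 2 * (1 + Complex.I) * Real.cosh x)) * amplitude x

lemma norm_saddleIntegrand (r x : ℝ) :
    ‖saddleIntegrand r x‖ = Real.exp (-(r ^ 2 * Real.cosh x)) * Real.exp x := by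
  rw [saddleIntegrand, norm_mul, norm_amplitude, Complex.norm_exp, ← Complex.ofReal_pow]
  congr 2
  rw [Complex.neg_re, mul_assoc, Complex.re_ofReal_mul, Complex.re_mul_ofReal]
  simp

lemma exp_neg_mul_cosh_mul_exp_le (r x : ℝ) :
    Real.exp (-(r ^ 2 * Real.cosh x)) * Real.exp x ≤
      Real.exp (-r ^ 2) * gaussianWeight 0 r x := by
  rw [gaussianWeight, pow_zero, one_mul, ← Real.exp_add, ← Real.exp_add, ← Real.exp_add]
  refine Real.exp_le_exp.2 ?_
  have h1 := mul_le_mul_of_nonneg_left (one_add_sq_div_two_le_cosh x) (sq_nonneg r)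
  have h2 := le_abs_self x
  have h3 := abs_nonneg x
  nlinarith

lemma continuous_saddleIntegrand (r : ℝ) : Continuous (saddleIntegrand r) := by
  have := continuous_amplitude
  have := Real.continuous_cosh
  unfold saddleIntegrand
  fun_prop

lemma integrable_saddleIntegrand {r : ℝ} (hr : 1 ≤ r) :
    MeasureTheory.Integrable (saddleIntegrand r) := by
  refine ((integrable_gaussianWeight Even.zero hr).const_mul (Real.exp (-r ^ 2))).mono'
    (continuous_saddleIntegrand r).aestronglyMeasurable (MeasureTheory.ae_of_all _ fun x => ?_)
  rw [norm_saddleIntegrand]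
  exact exp_neg_mul_cosh_mul_exp_le r x

/-- The approximant enters with a plus sign because the amplitude is -1 at the saddle. The two
errors come from cosh x - 1 - x²/2, which is nonnegative and hence does not enlarge the exponential,
and from the linearised amplitude. -/
lemma norm_saddleIntegrand_add_le (r x : ℝ) :
    ‖saddleIntegrand r x + Complex.exp (-(r ^ 2 * (1 + Complex.I))) *
      (Complex.exp (-(r ^ 2 * (1 + Complex.I) / 2) * x ^ 2) *
        (1 + (1 - 2 * Real.pi * Complex.I) * x))‖ ≤
      Real.exp (-r ^ 2) * (4 * r ^ 2 * gaussianWeight 4 r x +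
        (1 + 4 * Real.pi + 2 * Real.pi + 8 * Real.pi ^ 2) * gaussianWeight 2 r x) := by
  set d : ℝ := Real.cosh x - 1 - x ^ 2 / 2 with hd
  have hd0 : 0 ≤ d := by linarith [one_add_sq_div_two_le_cosh x]
  have hd1 : d ≤ x ^ 4 * Real.exp |x| := cosh_sub_le x
  set z : ℂ := ((r ^ 2 * d : ℝ) : ℂ) * (1 + Complex.I) with hz
  have hzre : 0 ≤ z.re := by
    rw [hz, Complex.re_ofReal_mul]
    simp
    positivity
  have hzn : ‖z‖ ≤ r ^ 2 * d * 2 := by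
    rw [hz, norm_mul, Complex.norm_real, Real.norm_of_nonneg (by positivity)]
    refine mul_le_mul_of_nonneg_left ?_ (by positivity)
    refine (norm_add_le _ _).trans ?_
    norm_num
  have hexp : Complex.exp (-(r ^ 2 * (1 + Complex.I) * Real.cosh x)) =
      Complex.exp (-(r ^ 2 * (1 + Complex.I))) *
        (Complex.exp (-(r ^ 2 * (1 + Complex.I) / 2) * x ^ 2) * Complex.exp (-z)) := by
    rw [← Complex.exp_add, ← Complex.exp_add, hz, hd]
    congr 1
    push_cast
    ring
  have hid : saddleIntegrand r x + Complex.exp (-(r ^ 2 * (1 + Complex.I))) *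
      (Complex.exp (-(r ^ 2 * (1 + Complex.I) / 2) * x ^ 2) *
        (1 + (1 - 2 * Real.pi * Complex.I) * x)) =
      Complex.exp (-(r ^ 2 * (1 + Complex.I))) *
      (Complex.exp (-(r ^ 2 * (1 + Complex.I) / 2) * x ^ 2) *
        ((Complex.exp (-z) - 1) * amplitude x +
          (amplitude x + 1 + (1 - 2 * Real.pi * Complex.I) * x))) := by
    rw [saddleIntegrand, hexp]
    ring
  have hn1 : ‖Complex.exp (-(r ^ 2 * (1 + Complex.I)))‖ = Real.exp (-r ^ 2) := by
    rw [Complex.norm_exp, ← Complex.ofReal_pow, Complex.neg_re, Complex.re_ofReal_mul]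
    simp
  have hn2 : ‖Complex.exp (-(r ^ 2 * (1 + Complex.I) / 2) * x ^ 2)‖ =
      Real.exp (-(r ^ 2 * x ^ 2 / 2)) := by
    rw [Complex.norm_exp, show -((r : ℂ) ^ 2 * (1 + Complex.I) / 2) * x ^ 2 =
      ((-(r ^ 2 * x ^ 2 / 2) : ℝ) : ℂ) * (1 + Complex.I) by push_cast; ring, Complex.re_ofReal_mul]
    simp
  rw [hid, norm_mul, norm_mul, hn1, hn2]
  refine mul_le_mul_of_nonneg_left ?_ (Real.exp_pos _).le
  have h1 : ‖(Complex.exp (-z) - 1) * amplitude x‖ ≤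
      4 * r ^ 2 * (x ^ 4 * Real.exp (5 * |x|)) := by
    rw [norm_mul, norm_amplitude]
    calc _ ≤ (2 * (r ^ 2 * (x ^ 4 * Real.exp |x|) * 2)) * Real.exp |x| := by
          have h3 : ‖Complex.exp (-z) - 1‖ ≤ 2 * (r ^ 2 * (x ^ 4 * Real.exp |x|) * 2) :=
            (norm_cexp_neg_sub_one_le hzre).trans
              (mul_le_mul_of_nonneg_left (hzn.trans (by gcongr)) two_pos.le)
          have h4 := le_abs_self x
          gcongr
      _ = 4 * r ^ 2 * (x ^ 4 * Real.exp (2 * |x|)) := by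
          rw [two_mul |x|, Real.exp_add]
          ring
      _ ≤ _ := by
          have := abs_nonneg x
          gcongr
          norm_num
  have h2 := (norm_add_le _ _).trans (add_le_add h1 (norm_amplitude_sub_le x))
  refine (mul_le_mul_of_nonneg_left h2 (Real.exp_pos _).le).trans_eq ?_
  rw [gaussianWeight, gaussianWeight]
  ring

/-- The linear term is odd and integrates to zero, leaving the Gaussian integral. The errors
r²·r^{-5} and r^{-3} are both smaller than the main 1/r by r^{-2}. -/
lemma exists_norm_integral_saddleIntegrand_add_le : ∃ C : ℝ, 0 ≤ C ∧ ∀ r : ℝ, 1 ≤ r →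
    ‖(∫ x, saddleIntegrand r x) + Complex.exp (-(r ^ 2 * (1 + Complex.I))) *
      (Real.pi / (r ^ 2 * (1 + Complex.I) / 2)) ^ (1 / 2 : ℂ)‖ ≤
        C * Real.exp (-r ^ 2) / r ^ 3 := by
  obtain ⟨C4, hC4, h4⟩ := exists_integral_gaussianWeight_le (p := 4) (by decide)
  obtain ⟨C2, hC2, h2⟩ := exists_integral_gaussianWeight_le (p := 2) (by decide)
  have hpi := Real.pi_pos
  refine ⟨4 * C4 + (1 + 4 * Real.pi + 2 * Real.pi + 8 * Real.pi ^ 2) * C2, by positivity,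
    fun r hr => ?_⟩
  have hr0 : 0 < r := by linarith
  set B : ℂ := r ^ 2 * (1 + Complex.I) / 2 with hB
  have hBre : 0 < B.re := by
    rw [hB, show (r : ℂ) ^ 2 * (1 + Complex.I) / 2 = ((r ^ 2 / 2 : ℝ) : ℂ) * (1 + Complex.I) by
      push_cast; ring, Complex.re_ofReal_mul]
    simp
    positivity
  have hG := integrable_cexp_neg_mul_sq hBre
  have hGx : MeasureTheory.Integrable fun x : ℝ => (x : ℂ) * Complex.exp (-B * x ^ 2) :=
    integrable_mul_cexp_neg_mul_sq hBre
  have hodd : ∫ x : ℝ, (x : ℂ) * Complex.exp (-B * x ^ 2) = 0 := by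
    have h := MeasureTheory.integral_neg_eq_self
      (fun x : ℝ => (x : ℂ) * Complex.exp (-B * x ^ 2)) MeasureTheory.volume
    simp only [Complex.ofReal_neg, neg_sq, neg_mul (_ : ℂ) (Complex.exp _)] at h
    rw [MeasureTheory.integral_neg] at h
    exact CharZero.neg_eq_self_iff.1 h
  have hmain : MeasureTheory.Integrable fun x : ℝ => Complex.exp (-(r ^ 2 * (1 + Complex.I))) *
      (Complex.exp (-B * x ^ 2) * (1 + (1 - 2 * Real.pi * Complex.I) * x)) := by
    refine MeasureTheory.Integrable.const_mul ?_ _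
    refine (hG.add (hGx.const_mul (1 - 2 * Real.pi * Complex.I))).congr
      (MeasureTheory.ae_of_all _ fun x => ?_)
    simp only [Pi.add_apply]
    ring
  have hval : ∫ x : ℝ, Complex.exp (-(r ^ 2 * (1 + Complex.I))) *
      (Complex.exp (-B * x ^ 2) * (1 + (1 - 2 * Real.pi * Complex.I) * x)) =
      Complex.exp (-(r ^ 2 * (1 + Complex.I))) * (Real.pi / B) ^ (1 / 2 : ℂ) := by
    rw [MeasureTheory.integral_const_mul, ← integral_gaussian_complex hBre]
    congr 1
    have h : ∀ x : ℝ, Complex.exp (-B * x ^ 2) * (1 + (1 - 2 * Real.pi * Complex.I) * x) =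
        Complex.exp (-B * x ^ 2) +
          (1 - 2 * Real.pi * Complex.I) * (x * Complex.exp (-B * x ^ 2)) := fun x => by ring
    simp only [h]
    rw [MeasureTheory.integral_add hG (hGx.const_mul _), MeasureTheory.integral_const_mul, hodd,
      mul_zero, add_zero]
  rw [← hval, ← MeasureTheory.integral_add (integrable_saddleIntegrand hr) hmain]
  have hi4 := (integrable_gaussianWeight (p := 4) (by decide) hr).const_mul (4 * r ^ 2)
  have hi2 := (integrable_gaussianWeight (p := 2) (by decide) hr).const_mul
    (1 + 4 * Real.pi + 2 * Real.pi + 8 * Real.pi ^ 2)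
  refine (MeasureTheory.norm_integral_le_of_norm_le ((hi4.add hi2).const_mul (Real.exp (-r ^ 2)))
    (MeasureTheory.ae_of_all _ fun x => norm_saddleIntegrand_add_le r x)).trans ?_
  rw [MeasureTheory.integral_const_mul]
  simp only [Pi.add_apply]
  rw [MeasureTheory.integral_add hi4 hi2, MeasureTheory.integral_const_mul,
    MeasureTheory.integral_const_mul]
  have h4' := h4 r hr
  have h2' := h2 r hr
  calc _ ≤ Real.exp (-r ^ 2) * (4 * r ^ 2 * (C4 / r ^ (4 + 1)) +
        (1 + 4 * Real.pi + 2 * Real.pi + 8 * Real.pi ^ 2) * (C2 / r ^ (2 + 1))) := by gcongr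
    _ = _ := by
      field_simp
      ring

/-- An L¹ bound for the saddle integrand, needed to convert the pointwise relative error O(1/√n)
into an error of the integral. -/
lemma exists_integral_exp_neg_mul_cosh_le : ∃ C : ℝ, 0 ≤ C ∧ ∀ r : ℝ, 1 ≤ r →
    MeasureTheory.Integrable (fun x => Real.exp (-(r ^ 2 * Real.cosh x)) * Real.exp x) ∧
    ∫ x, Real.exp (-(r ^ 2 * Real.cosh x)) * Real.exp x ≤ C * Real.exp (-r ^ 2) / r := by
  obtain ⟨C, hC, h⟩ := exists_integral_gaussianWeight_le (p := 0) Even.zero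
  refine ⟨C, hC, fun r hr => ?_⟩
  have hi := (integrable_saddleIntegrand hr).norm
  simp only [norm_saddleIntegrand] at hi
  refine ⟨hi, ?_⟩
  refine (MeasureTheory.integral_mono hi
    ((integrable_gaussianWeight Even.zero hr).const_mul (Real.exp (-r ^ 2)))
    (exp_neg_mul_cosh_mul_exp_le r)).trans ?_
  rw [MeasureTheory.integral_const_mul]
  have := h r hr
  calc _ ≤ Real.exp (-r ^ 2) * (C / r ^ (0 + 1)) := by gcongr
    _ = _ := by
      rw [zero_add, pow_one]
      ring

/-! ### Rescaling to the saddle. -/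

lemma image_mul_exp_univ {l : ℝ} (hl : 0 < l) :
    (fun x : ℝ => l * Real.exp x) '' Set.univ = Set.Ioi 0 := by
  ext y
  simp only [Set.image_univ, Set.mem_range, Set.mem_Ioi]
  constructor
  · rintro ⟨x, rfl⟩
    positivity
  · intro hy
    exact ⟨Real.log (y / l), by rw [Real.exp_log (by positivity)]; field_simp⟩

lemma injOn_mul_exp {l : ℝ} (hl : 0 < l) :
    Set.InjOn (fun x : ℝ => l * Real.exp x) Set.univ := fun _ _ _ _ h =>
  Real.exp_injective (mul_left_cancel₀ hl.ne' h)

lemma integral_Ioi_eq_integral_mul_exp {E : Type*} [NormedAddCommGroup E] [NormedSpace ℝ E]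
    {l : ℝ} (hl : 0 < l) (f : ℝ → E) :
    ∫ s in Set.Ioi (0 : ℝ), f s = ∫ x : ℝ, (l * Real.exp x) • f (l * Real.exp x) := by
  have h := MeasureTheory.integral_image_eq_integral_abs_deriv_smul (s := Set.univ)
    (f := fun x : ℝ => l * Real.exp x) (f' := fun x => l * Real.exp x) MeasurableSet.univ
    (fun x _ => ((Real.hasDerivAt_exp x).const_mul l).hasDerivWithinAt) (injOn_mul_exp hl) f
  rw [image_mul_exp_univ hl, MeasureTheory.setIntegral_univ] at h
  rw [h]
  refine MeasureTheory.integral_congr_ae (MeasureTheory.ae_of_all _ fun x => ?_)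
  simp only
  rw [abs_of_pos (by positivity)]

lemma integrableOn_Ioi_iff_integrable_mul_exp {E : Type*} [NormedAddCommGroup E]
    [NormedSpace ℝ E] {l : ℝ} (hl : 0 < l) (f : ℝ → E) :
    MeasureTheory.IntegrableOn f (Set.Ioi 0) ↔
      MeasureTheory.Integrable fun x : ℝ => (l * Real.exp x) • f (l * Real.exp x) := by
  have h := MeasureTheory.integrableOn_image_iff_integrableOn_abs_deriv_smul (s := Set.univ)
    (f := fun x : ℝ => l * Real.exp x) (f' := fun x => l * Real.exp x) MeasurableSet.univ
    (fun x _ => ((Real.hasDerivAt_exp x).const_mul l).hasDerivWithinAt) (injOn_mul_exp hl) f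
  rw [image_mul_exp_univ hl, MeasureTheory.integrableOn_univ] at h
  rw [h]
  have h2 : ∀ x : ℝ, |l * Real.exp x| = l * Real.exp x := fun x => abs_of_pos (by positivity)
  simp only [h2]

lemma eighthRoot_eq : σ = (√2 / 2 : ℝ) * (1 + Complex.I) := by
  apply Complex.ext <;> simp

/-- The abscissa `√(n / (2π))` of the saddle point. -/
noncomputable def saddleScale (n : ℕ) : ℝ := √n / (√2 * √Real.pi)

/-- The integrand approximating that of `noerlundIntegral (2π) n`. -/
noncomputable def saddleApprox (n : ℕ) (s : ℝ) : ℂ :=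
  Complex.exp (-((2 * Real.pi : ℝ) * σ * s)) * saddleFactor n s

lemma saddleScale_pos {n : ℕ} (hn : 1 ≤ n) : 0 < saddleScale n := by
  have : (0 : ℝ) < n := by exact_mod_cast hn
  have := Real.pi_pos
  unfold saddleScale
  positivity

/-- At the scale l = √(n/(2π)) the terms 2πσs and nσ/s have equal coefficients (`e1`, `e2`) and
combine into a cosh, while n/(2l²) = π (`e3`) gives the phase. The Jacobian supplies the e^x of the
amplitude. -/
lemma smul_saddleApprox {n : ℕ} (hn : 1 ≤ n) {r : ℝ} (hr : r ^ 2 = 2 * √Real.pi * √n) (x : ℝ) :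
    (saddleScale n * Real.exp x) • saddleApprox n (saddleScale n * Real.exp x) =
      (saddleScale n : ℂ) * saddleIntegrand r x := by
  have hn0 : (0 : ℝ) < n := by exact_mod_cast hn
  have hl := saddleScale_pos hn
  have hp0 : 0 < √Real.pi := Real.sqrt_pos.2 Real.pi_pos
  have hp2 : √Real.pi ^ 2 = Real.pi := Real.sq_sqrt Real.pi_pos.le
  have hq0 : 0 < √(n : ℝ) := Real.sqrt_pos.2 hn0
  have hq2 : √(n : ℝ) ^ 2 = n := Real.sq_sqrt hn0.le
  have h2 : √2 ^ 2 = 2 := Real.sq_sqrt two_pos.le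
  have h20 : 0 < √2 := Real.sqrt_pos.2 two_pos
  obtain ⟨l, hldef⟩ : ∃ l, l = saddleScale n := ⟨_, rfl⟩
  rw [← hldef] at hl ⊢
  rw [saddleScale] at hldef
  have e1 : 2 * Real.pi * (√2 / 2) * l = √Real.pi * √n := by
    generalize √Real.pi = p at *
    rw [hldef, ← hp2]
    field_simp
  have e2 : n * (√2 / 2) / l = √Real.pi * √n := by
    generalize √(n : ℝ) = q at *
    rw [hldef, ← hq2]
    field_simp
    linear_combination h2
  have e3 : n / (2 * l ^ 2) = Real.pi := by
    generalize √Real.pi = p at *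
    generalize √(n : ℝ) = q at *
    rw [hldef, ← hp2, ← hq2]
    field_simp
    linear_combination h2
  have hE := Real.exp_pos x
  rw [saddleApprox, saddleFactor, saddleIntegrand, amplitude, ← Complex.exp_add, ← Complex.exp_add,
    Complex.real_smul, Complex.ofReal_mul, mul_assoc, Complex.ofReal_exp, ← Complex.exp_add]
  rw [← Complex.ofReal_exp]
  congr 2
  rw [div_pow, eighthRoot_sq, eighthRoot_eq, ← Complex.ofReal_pow r, hr, Real.cosh_eq,
    Real.exp_neg, Real.exp_neg, two_mul x, Real.exp_add]
  have e1' : ((2 * Real.pi * (√2 / 2) * l : ℝ) : ℂ) = (√Real.pi * √n : ℝ) := by rw [e1]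
  have e2' : ((n * (√2 / 2) / l : ℝ) : ℂ) = (√Real.pi * √n : ℝ) := by rw [e2]
  have e3' : ((n / (2 * l ^ 2) : ℝ) : ℂ) = (Real.pi : ℝ) := by rw [e3]
  generalize Real.exp x = E at *
  have hEc : (E : ℂ) ≠ 0 := by exact_mod_cast hE.ne'
  have hlc : (l : ℂ) ≠ 0 := by exact_mod_cast hl.ne'
  push_cast at e1' e2' e3' ⊢
  have t1 : (n : ℂ) * (√2 / 2 * (1 + Complex.I) / (l * E)) =
      (√Real.pi * √n) * (1 + Complex.I) / E := by
    rw [← e2']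
    field_simp
  have t2 : (n : ℂ) * (Complex.I / (l * E) ^ 2 / 2) = Complex.I * (Real.pi * ((E : ℂ) * E)⁻¹) := by
    rw [← e3']
    field_simp
  have t3 : 2 * (Real.pi : ℂ) * (√2 / 2 * (1 + Complex.I)) * (l * E) =
      (√Real.pi * √n) * (1 + Complex.I) * E := by
    rw [← e1']
    ring
  linear_combination -t1 + t2 - t3

lemma norm_saddleApprox (n : ℕ) (s : ℝ) : ‖saddleApprox n s‖ =
    Real.exp (-(2 * Real.pi * (√2 / 2) * s)) * Real.exp (-(n * (√2 / 2) / s)) := by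
  rw [saddleApprox, norm_mul, norm_saddleFactor, norm_cexp_neg_eighthRoot]

lemma integrableOn_saddleApprox {n : ℕ} (hn : 1 ≤ n) {r : ℝ} (hr1 : 1 ≤ r)
    (hr : r ^ 2 = 2 * √Real.pi * √n) :
    MeasureTheory.IntegrableOn (saddleApprox n) (Set.Ioi 0) := by
  rw [integrableOn_Ioi_iff_integrable_mul_exp (saddleScale_pos hn)]
  simp only [smul_saddleApprox hn hr]
  exact (integrable_saddleIntegrand hr1).const_mul _

lemma integral_saddleApprox {n : ℕ} (hn : 1 ≤ n) {r : ℝ} (hr : r ^ 2 = 2 * √Real.pi * √n) :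
    ∫ s in Set.Ioi (0 : ℝ), saddleApprox n s = saddleScale n * ∫ x, saddleIntegrand r x := by
  rw [integral_Ioi_eq_integral_mul_exp (saddleScale_pos hn)]
  simp only [smul_saddleApprox hn hr]
  rw [MeasureTheory.integral_const_mul]

lemma integral_norm_saddleApprox {n : ℕ} (hn : 1 ≤ n) {r : ℝ}
    (hr : r ^ 2 = 2 * √Real.pi * √n) :
    ∫ s in Set.Ioi (0 : ℝ), ‖saddleApprox n s‖ =
      saddleScale n * ∫ x, Real.exp (-(r ^ 2 * Real.cosh x)) * Real.exp x := by
  have hl := saddleScale_pos hn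
  rw [integral_Ioi_eq_integral_mul_exp hl, ← MeasureTheory.integral_const_mul]
  refine MeasureTheory.integral_congr_ae (MeasureTheory.ae_of_all _ fun x => ?_)
  have h := congrArg norm (smul_saddleApprox hn hr x)
  rw [norm_smul, norm_mul (saddleScale n : ℂ), Complex.norm_real, Real.norm_of_nonneg hl.le,
    Real.norm_of_nonneg (by positivity), norm_saddleIntegrand] at h
  exact h

lemma exists_norm_noerlundIntegral_sub_le : ∃ C : ℝ, 0 ≤ C ∧ ∀ n : ℕ, 144 ≤ n → ∀ r : ℝ, 1 ≤ r →
    r ^ 2 = 2 * √Real.pi * √n →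
    ‖noerlundIntegral (2 * Real.pi) n - τ * ∫ s in Set.Ioi (0 : ℝ), saddleApprox n s‖ ≤
      C * (saddleScale n / √n * (Real.exp (-r ^ 2) / r) + Real.exp (-(6 * √n))) := by
  obtain ⟨C1, hC1, h1⟩ := exists_norm_rayFactor_pow_sub_saddleFactor_le
  obtain ⟨C2, hC2, h2⟩ := exists_integral_exp_neg_mul_cosh_le
  have hpi := Real.pi_pos
  set K : ℝ := ∫ s in Set.Ioi (0 : ℝ), Real.exp (-(2 * Real.pi * (√2 / 2) * s)) with hK
  have hK0 : 0 ≤ K := MeasureTheory.integral_nonneg fun s => (Real.exp_pos _).le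
  refine ⟨C1 * C2 + 2 * K, by positivity, fun n hn r hr1 hr => ?_⟩
  have hn1 : 1 ≤ n := by omega
  have hl := saddleScale_pos hn1
  have hr0 : 0 < r := by linarith
  have hS := integrableOn_saddleApprox hn1 hr1 hr
  have hJ := integrableOn_noerlundIntegral (a := 2 * Real.pi) (by positivity) n
  rw [noerlundIntegral_eq, ← mul_sub, norm_mul, norm_eighthRootConj, one_mul,
    ← MeasureTheory.integral_sub hJ hS]
  have hE := integrableOn_exp_neg_mul (r := 2 * Real.pi * (√2 / 2)) (by positivity)
  have hb1 := hS.norm.const_mul (C1 / √n)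
  have hb2 := hE.const_mul (2 * Real.exp (-(6 * √n)))
  refine (MeasureTheory.norm_integral_le_of_norm_le (hb1.add hb2)
    ((MeasureTheory.ae_restrict_iff' measurableSet_Ioi).2
      (MeasureTheory.ae_of_all _ fun s hs => ?_))).trans ?_
  · simp only [Pi.add_apply]
    rw [saddleApprox, ← mul_sub, norm_mul, norm_cexp_neg_eighthRoot, ← saddleApprox,
      norm_saddleApprox]
    refine (mul_le_mul_of_nonneg_left (h1 n hn s hs) (Real.exp_pos _).le).trans_eq ?_
    ring
  · simp only [Pi.add_apply]
    rw [MeasureTheory.integral_add hb1 hb2, MeasureTheory.integral_const_mul,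
      MeasureTheory.integral_const_mul, integral_norm_saddleApprox hn1 hr, ← hK]
    have h3 := (h2 r hr1).2
    have h4 : 0 ≤ saddleScale n / √n * (Real.exp (-r ^ 2) / r) := by positivity
    have h5 : 0 ≤ Real.exp (-(6 * √n)) := (Real.exp_pos _).le
    calc _ ≤ C1 / √n * (saddleScale n * (C2 * Real.exp (-r ^ 2) / r)) +
          2 * Real.exp (-(6 * √n)) * K := by gcongr
      _ = C1 * C2 * (saddleScale n / √n * (Real.exp (-r ^ 2) / r)) +
          2 * K * Real.exp (-(6 * √n)) := by ring
      _ ≤ (C1 * C2 + 2 * K) * (saddleScale n / √n * (Real.exp (-r ^ 2) / r)) +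
          (C1 * C2 + 2 * K) * Real.exp (-(6 * √n)) := by
        gcongr
        · linarith
        · have : 0 ≤ C1 * C2 := by positivity
          linarith
      _ = _ := by ring

/-! ### The constants of the main term and the conclusion. -/

lemma eighthRootConj_eq_cexp : τ = Complex.exp (-(Real.pi / 4 : ℝ) * Complex.I) := by
  rw [← Complex.ofReal_neg, Complex.exp_mul_I, ← Complex.ofReal_cos, ← Complex.ofReal_sin,
    Real.cos_neg, Real.sin_neg, Real.cos_pi_div_four, Real.sin_pi_div_four]
  apply Complex.ext <;> simp

lemma pi_div_cpow_half {r : ℝ} (hr : 0 < r) :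
    ((Real.pi : ℂ) / (r ^ 2 * (1 + Complex.I) / 2)) ^ (1 / 2 : ℂ) =
      √(√2 * Real.pi / r ^ 2) * Complex.exp (-(Real.pi / 8 : ℝ) * Complex.I) := by
  have hpi := Real.pi_pos
  have h2 : √2 ^ 2 = 2 := Real.sq_sqrt two_pos.le
  have h20 : 0 < √2 := Real.sqrt_pos.2 two_pos
  set κ : ℝ := √(√2 * Real.pi / r ^ 2) with hκ
  have hκ0 : 0 < κ := by rw [hκ]; positivity
  have hκ2 : κ ^ 2 = √2 * Real.pi / r ^ 2 := Real.sq_sqrt (by positivity)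
  have hre : 0 < (κ * Complex.exp (-(Real.pi / 8 : ℝ) * Complex.I)).re := by
    rw [Complex.re_ofReal_mul, ← Complex.ofReal_neg, Complex.exp_ofReal_mul_I_re]
    have : 0 < Real.cos (-(Real.pi / 8)) := Real.cos_pos_of_mem_Ioo ⟨by linarith, by linarith⟩
    positivity
  have hsq : (κ * Complex.exp (-(Real.pi / 8 : ℝ) * Complex.I)) ^ 2 =
      Real.pi / (r ^ 2 * (1 + Complex.I) / 2) := by
    have hrc : (r : ℂ) ≠ 0 := by exact_mod_cast hr.ne'
    have h2c : (√2 : ℂ) ^ 2 = 2 := by exact_mod_cast h2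
    have hpc : (Real.pi : ℂ) ≠ 0 := by exact_mod_cast hpi.ne'
    have hσ : σ ≠ 0 := left_ne_zero_of_mul_eq_one eighthRoot_mul_conj
    have h1I : 1 + Complex.I = (√2 : ℂ) * σ := by
      rw [eighthRoot_eq]
      push_cast
      linear_combination -(1 + Complex.I) / 2 * h2c
    have h2n : (√2 : ℂ) ≠ 0 := by exact_mod_cast h20.ne'
    have hτ : τ = σ⁻¹ := eq_inv_of_mul_eq_one_right eighthRoot_mul_conj
    rw [mul_pow, ← Complex.ofReal_pow, hκ2, ← Complex.exp_nat_mul, h1I]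
    have : ((2 : ℕ) : ℂ) * (-(Real.pi / 8 : ℝ) * Complex.I) = -(Real.pi / 4 : ℝ) * Complex.I := by
      push_cast
      ring
    rw [this, ← eighthRootConj_eq_cexp, hτ]
    push_cast
    field_simp
    linear_combination h2c
  rw [← hsq, one_div]
  -- The positive real part identifies this square root as the principal one.
  exact Complex.sq_cpow_two_inv hre

/-- The leading contribution of the saddle point. -/
noncomputable def saddleMain (n : ℕ) (r : ℝ) : ℂ :=
  -(τ * (saddleScale n * (Complex.exp (-(r ^ 2 * (1 + Complex.I))) *
    (Real.pi / (r ^ 2 * (1 + Complex.I) / 2)) ^ (1 / 2 : ℂ))))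

lemma two_mul_saddleScale_mul_sqrt {n : ℕ} (hn : 1 ≤ n) {r : ℝ} (hr0 : 0 < r)
    (hr : r ^ 2 = 2 * √Real.pi * √n) :
    2 * saddleScale n * √(√2 * Real.pi / r ^ 2) = (2 * n / Real.pi) ^ (1 / 4 : ℝ) := by
  have hn0 : (0 : ℝ) < n := by exact_mod_cast hn
  have hl := saddleScale_pos hn
  have hpi := Real.pi_pos
  have hp0 : 0 < √Real.pi := Real.sqrt_pos.2 Real.pi_pos
  have hp2 : √Real.pi ^ 2 = Real.pi := Real.sq_sqrt Real.pi_pos.le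
  have hq0 : 0 < √(n : ℝ) := Real.sqrt_pos.2 hn0
  have hq2 : √(n : ℝ) ^ 2 = n := Real.sq_sqrt hn0.le
  have h2 : √2 ^ 2 = 2 := Real.sq_sqrt two_pos.le
  have h20 : 0 < √2 := Real.sqrt_pos.2 two_pos
  have hκ2 : √(√2 * Real.pi / r ^ 2) ^ 2 = √2 * Real.pi / r ^ 2 := Real.sq_sqrt (by positivity)
  have h4 : (2 * saddleScale n * √(√2 * Real.pi / r ^ 2)) ^ 4 = 2 * n / Real.pi := by
    rw [show (2 * saddleScale n * √(√2 * Real.pi / r ^ 2)) ^ 4 =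
      16 * saddleScale n ^ 4 * (√(√2 * Real.pi / r ^ 2) ^ 2) ^ 2 by ring, hκ2, hr, saddleScale]
    generalize √Real.pi = p at *
    generalize √(n : ℝ) = q at *
    rw [← hp2, ← hq2]
    field_simp
    rw [h2]
    norm_num
  rw [← h4, one_div]
  exact (Real.pow_rpow_inv_natCast (by positivity) (by norm_num : (4 : ℕ) ≠ 0)).symm

/-- The phase 5π/8 is π - π/4 - π/8: the sign at the saddle, the direction of the ray, and the
square root in the Gaussian integral. -/
lemma saddleMain_add_conj {n : ℕ} (hn : 1 ≤ n) {r : ℝ} (hr0 : 0 < r)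
    (hr : r ^ 2 = 2 * √Real.pi * √n) :
    saddleMain n r + starRingEnd ℂ (saddleMain n r) = mainTerm n := by
  have hsqrt : √(Real.pi * n) = √Real.pi * √n := Real.sqrt_mul Real.pi_pos.le _
  have h1 : saddleMain n r =
      ((saddleScale n * √(√2 * Real.pi / r ^ 2) * Real.exp (-r ^ 2) : ℝ) : ℂ) *
        Complex.exp ((-(r ^ 2 - 5 * Real.pi / 8) : ℝ) * Complex.I) := by
    have h2 : Complex.exp ((-(r ^ 2 - 5 * Real.pi / 8) : ℝ) * Complex.I) =
        -(Complex.exp (-(Real.pi / 4 : ℝ) * Complex.I) *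
          (Complex.exp (-(r ^ 2 * Complex.I)) *
            Complex.exp (-(Real.pi / 8 : ℝ) * Complex.I))) := by
      have h3 : ∀ w : ℂ, -Complex.exp w = Complex.exp (w + Real.pi * Complex.I) := fun w => by
        rw [Complex.exp_add, Complex.exp_pi_mul_I, mul_neg_one]
      rw [← Complex.exp_add, ← Complex.exp_add, h3]
      congr 1
      push_cast
      ring
    have h3 : Complex.exp (-((r : ℂ) ^ 2 * (1 + Complex.I))) =
        (Real.exp (-r ^ 2) : ℝ) * Complex.exp (-(r ^ 2 * Complex.I)) := by
      rw [Complex.ofReal_exp, ← Complex.exp_add]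
      congr 1
      push_cast
      ring
    rw [saddleMain, pi_div_cpow_half hr0, h2, h3, eighthRootConj_eq_cexp]
    push_cast
    ring
  rw [Complex.add_conj, h1, Complex.re_ofReal_mul, Complex.exp_ofReal_mul_I_re, Real.cos_neg,
    mainTerm, ← two_mul_saddleScale_mul_sqrt hn hr0 hr, hsqrt, hr]
  rw [show -2 * (√Real.pi * √(n : ℝ)) = -(2 * √Real.pi * √n) by ring, ← mul_assoc 2 (√Real.pi)]
  push_cast
  ring

theorem noerlundIntegral_sub_mainTerm_isBigO :
    (fun n : ℕ => (noerlundIntegral (2 * Real.pi) n +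
      starRingEnd ℂ (noerlundIntegral (2 * Real.pi) n)) - (mainTerm n : ℂ)) =O[atTop]
      (fun n : ℕ => (n : ℝ) ^ (-(1 / 4) : ℝ) * Real.exp (-2 * √(Real.pi * n))) := by
  obtain ⟨C1, hC1, h1⟩ := exists_norm_noerlundIntegral_sub_le
  obtain ⟨C2, hC2, h2⟩ := exists_norm_integral_saddleIntegrand_add_le
  have hpi := Real.pi_pos
  have hp0 : 0 < √Real.pi := Real.sqrt_pos.2 Real.pi_pos
  have hp1 : 1 ≤ √Real.pi := Real.one_le_sqrt.2 (by linarith [Real.pi_gt_three])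
  have h20 : 0 < √2 := Real.sqrt_pos.2 two_pos
  have hE := (exp_neg_mul_sqrt_isBigO (c := 6) (by linarith [sqrt_pi_lt])).const_mul_left (2 * C1)
  have hmain : (fun n : ℕ => (n : ℝ) ^ (-(1 / 4) : ℝ) * Real.exp (-2 * √(Real.pi * n))) =O[atTop]
      (fun n : ℕ => (n : ℝ) ^ (-(1 / 4) : ℝ) * Real.exp (-2 * √(Real.pi * n))) := isBigO_refl _ _
  -- The summands are the coefficients of `saddleScale n / √n` and `saddleScale n / r ^ 2`; the
  -- common denominator comes from 1/r = n^{-1/4}/√(2√π). The leading 2 accounts for the conjugate.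
  set A : ℝ := 2 * (C1 / (√2 * √Real.pi) + C2 / (√2 * √Real.pi * (2 * √Real.pi))) /
    √(2 * √Real.pi) with hA
  refine IsBigO.trans (IsBigO.of_bound 1 ?_) (hE.add (hmain.const_mul_left A))
  filter_upwards [eventually_ge_atTop 144] with n hn
  have hn1 : 1 ≤ n := by omega
  have hn0 : (0 : ℝ) < n := by exact_mod_cast hn1
  have hnr : (1 : ℝ) ≤ n := by exact_mod_cast hn1
  have hq0 : 0 < √(n : ℝ) := Real.sqrt_pos.2 hn0
  have hq1 : 1 ≤ √(n : ℝ) := Real.one_le_sqrt.2 hnr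
  have hl := saddleScale_pos hn1
  set r : ℝ := √(2 * √Real.pi * √n) with hrdef
  have hr : r ^ 2 = 2 * √Real.pi * √n := Real.sq_sqrt (by positivity)
  have hr1 : 1 ≤ r := Real.one_le_sqrt.2 (by nlinarith)
  have hr0 : 0 < r := by linarith
  have hr' : r = √(2 * √Real.pi) * (n : ℝ) ^ (1 / 4 : ℝ) := by
    rw [hrdef, Real.sqrt_mul (by positivity), Real.sqrt_eq_rpow (√(n : ℝ)), Real.sqrt_eq_rpow (n : ℝ),
      ← Real.rpow_mul hn0.le]
    norm_num
  have hexp : Real.exp (-2 * √(Real.pi * n)) = Real.exp (-r ^ 2) := by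
    rw [hr, Real.sqrt_mul hpi.le]
    congr 1
    ring
  have hD : ‖noerlundIntegral (2 * Real.pi) n - saddleMain n r‖ ≤
      C1 * (saddleScale n / √n * (Real.exp (-r ^ 2) / r) + Real.exp (-(6 * √n))) +
        saddleScale n * (C2 * Real.exp (-r ^ 2) / r ^ 3) := by
    have h3 := h1 n hn r hr1 hr
    have h4 : ‖τ * (∫ s in Set.Ioi (0 : ℝ), saddleApprox n s) - saddleMain n r‖ ≤
        saddleScale n * (C2 * Real.exp (-r ^ 2) / r ^ 3) := by
      rw [integral_saddleApprox hn1 hr, saddleMain, sub_neg_eq_add, ← mul_add, ← mul_add, norm_mul,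
        norm_mul, norm_eighthRootConj, one_mul, Complex.norm_real, Real.norm_of_nonneg hl.le]
      exact mul_le_mul_of_nonneg_left (h2 r hr1) hl.le
    have h5 := norm_add_le
      (noerlundIntegral (2 * Real.pi) n - τ * ∫ s in Set.Ioi (0 : ℝ), saddleApprox n s)
      (τ * (∫ s in Set.Ioi (0 : ℝ), saddleApprox n s) - saddleMain n r)
    rw [sub_add_sub_cancel] at h5
    linarith
  have hsplit : (noerlundIntegral (2 * Real.pi) n +
      starRingEnd ℂ (noerlundIntegral (2 * Real.pi) n)) - (mainTerm n : ℂ) =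
      (noerlundIntegral (2 * Real.pi) n - saddleMain n r) +
        starRingEnd ℂ (noerlundIntegral (2 * Real.pi) n - saddleMain n r) := by
    rw [← saddleMain_add_conj hn1 hr0 hr, map_sub]
    ring
  rw [hsplit, one_mul, hexp]
  refine (norm_add_le _ _).trans ?_
  rw [RCLike.norm_conj]
  refine le_trans ?_ (le_abs_self _)
  have hfin : 2 * (C1 * (saddleScale n / √n * (Real.exp (-r ^ 2) / r)) +
      saddleScale n * (C2 * Real.exp (-r ^ 2) / r ^ 3)) =
      A * ((n : ℝ) ^ (-(1 / 4) : ℝ) * Real.exp (-r ^ 2)) := by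
    have h6 : (n : ℝ) ^ (-(1 / 4) : ℝ) = √(2 * √Real.pi) / r := by
      rw [hr', Real.rpow_neg hn0.le]
      field_simp
    rw [h6, hA, pow_succ r 2, hr, saddleScale]
    have : 0 < √(2 * √Real.pi) := by positivity
    field_simp
  linarith

theorem theorem1 :
    (∀ n : ℕ, 1 ≤ n → b n = newtonCoeff regZeta n) ∧
    (fun n : ℕ => b n - (mainTerm n : ℂ)) =O[atTop]
      (fun n : ℕ => (n : ℝ) ^ (-(1 / 4) : ℝ) * Real.exp (-2 * √(Real.pi * n))) := by
  refine ⟨fun n hn => b_eq_newtonCoeff hn, ?_⟩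
  exact (b_sub_noerlundIntegral_isBigO.add noerlundIntegral_sub_mainTerm_isBigO).congr_left
    fun n => sub_add_sub_cancel _ _ _
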